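/- **Dirac points for small $\varepsilon$.** Let $V_e(x)=\sum_{p\in\{0,2,4,\dots\}}v_p\cos(2\pi p x)$, $v_p\in\mathbb R$, $\sum_p|v_p|<\infty$ (for instance any $C^1$ even-index cosine series), and let $n\ge 1$ be an integer. Then there are $\varepsilon_0>0$ and a real-valued function $\varepsilon\mapsto E^{(\varepsilon)}_{\star,n}$, continuous on $(-\varepsilon_0,\varepsilon_0)$, with $E^{(0)}_{\star,n}=\pi^2(2n+1)^2$, such that for every $\varepsilon\in(-\varepsilon_0,\varepsilon_0)$ the pair $(k_\star,E_\star)=(\pi,E^{(\varepsilon)}_{\star,n})$ is a Dirac point of $H=-\partial_x^2+\varepsilon V_e(x)$, with symmetry $\mathcal S=\mathcal I$, $\mathcal I[f](x)=f(-x)$, and decomposition $H^2_{k_\star}=H^2_{k_\star,e}\oplus H^2_{k_\star,o}$. Here $L^2_k$ is the space of $f\in L^2_{\rm loc}(\mathbb R;\mathbb C)$ with $f(x+1)=e^{ik}f(x)$, $H^2_k=L^2_k\cap H^2_{\rm loc}$, and $L^2_{k,e}$ (resp. $L^2_{k,o}$) consists of the functions $e^{ikx}\sum_m p(m)e^{2\pi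 i m x}\in L^2_k$ with $\sum_m|p(m)|^2<\infty$ and $p(m)=0$ for odd (resp. even) $m$; $H^2_{k,\sigma}=H^2_k\cap L^2_{k,\sigma}$ for $\sigma=e,o$. Let $E_1(k)\le E_2(k)\le\cdots$ denote the eigenvalues of $H$ on $L^2_k$, repeated according to multiplicity. That $(k_\star,E_\star)$ is a Dirac point of $H$ with the stated symmetry and decomposition means that $k_\star\in[0,2\pi]$ and: 1. there is $b_\star\ge1$ with $E_\star=E_{b_\star}(k_\star)=E_{b_\star+1}(k_\star)$; 2. $E_\star$ is an $L^2_{k_\star}$-eigenvalue of $H$ of multiplicity $2$; 3. $H^2_{k_\star}=H^2_{k_\star,e}\oplus H^2_{k_\star,o}$, and $H$ maps $H^2_{k_\star,e}$ into $L^2_{k_\star,e}$ and $H^2_{k_\star,o}$ into $L^2_{k_\star,o}$; 4. $\mathcal S$ maps $H^2_{k_\star,e}$ into $H^2_{k_\star,o}$ and $H^2_{k_\star,o}$ into $H^2_{k_\star,e}$, $\mathcal S\circ\mathcal S=I$, and $\mathcal S$ commutes with $H$ on $H^2_{k_\star}$; 5. the $L^2_{k_\star}$-nullspace of $H-E_\star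 I$ is spanned by some $\Phi_1\in H^2_{k_\star,e}$ and $\Phi_2=\mathcal S[\Phi_1]$ with $\langle\Phi_a,\Phi_b\rangle_{L^2[0,1]}=\delta_{ab}$, $a,b\in\{1,2\}$; 6. there are a real $\lambda_\sharp\ne0$, $\zeta_0>0$, eigenpairs $(\Phi_\pm(\cdot;k),E_\pm(k))$ with $0\ne\Phi_\pm(\cdot;k)\in H^2_k$ and $H\Phi_\pm(\cdot;k)=E_\pm(k)\Phi_\pm(\cdot;k)$ for $|k-k_\star|<\zeta_0$, and real-valued $C^\infty$ functions $\eta_\pm$ on $(-\zeta_0,\zeta_0)$ with $\eta_\pm(0)=0$, such that for $|k-k_\star|<\zeta_0$ $$E_\pm(k)-E_\star=\pm\lambda_\sharp\,(k-k_\star)\bigl(1+\eta_\pm(k-k_\star)\bigr).$$ -/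

import Mathlib

open MeasureTheory Set
open scoped ContDiff

noncomputable section

namespace Hill

/-- Functions `ℝ → ℂ` that are square integrable on every bounded interval. -/
def MemL2Loc (f : ℝ → ℂ) : Prop :=
  ∀ a b : ℝ, MemLp f 2 (volume.restrict (Icc a b))

/-- The space `L²_k` of `k`-pseudo-periodic functions: `f ∈ L²_loc` and
`f (x + 1) = e^{ik} f x`. Its elements are kept as honest functions; all its defining conditions
are insensitive to changes on null sets. -/
def L2k (k : ℝ) : Submodule ℂ (ℝ → ℂ) where
  carrier := {f | MemL2Loc f ∧ ∀ᵐ x : ℝ, f (x + 1) = Complex.exp (Complex.I * k) * f x}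
  zero_mem' := ⟨fun _ _ => MemLp.zero, by simp⟩
  add_mem' := by
    rintro f g ⟨hf, hf'⟩ ⟨hg, hg'⟩
    refine ⟨fun a b => (hf a b).add (hg a b), ?_⟩
    filter_upwards [hf', hg'] with x h1 h2
    simp only [Pi.add_apply, h1, h2, mul_add]
  smul_mem' := by
    rintro c f ⟨hf, hf'⟩
    refine ⟨fun a b => (hf a b).const_smul c, ?_⟩
    filter_upwards [hf'] with x h1
    simp only [Pi.smul_apply, smul_eq_mul, h1]
    ring

lemma MemL2Loc.locallyIntegrable {f : ℝ → ℂ} (hf : MemL2Loc f) : LocallyIntegrable f volume := by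
  intro x
  refine ⟨Icc (x - 1) (x + 1), Icc_mem_nhds (by linarith) (by linarith), ?_⟩
  exact (hf (x - 1) (x + 1)).integrable one_le_two

/-- If `f'` is an indefinite integral of `g`, then `f'' = g` almost everywhere. -/
lemma deriv_deriv_ae_eq {f g : ℝ → ℂ} (hg : LocallyIntegrable g volume)
    (h : ∀ a b : ℝ, deriv f b - deriv f a = ∫ x in a..b, g x) :
    deriv (deriv f) =ᵐ[volume] g := by
  filter_upwards [LocallyIntegrable.ae_hasDerivAt_integral hg] with x hx
  have h1 : deriv f = fun y => deriv f 0 + ∫ t in (0 : ℝ)..y, g t := by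
    funext y
    rw [← h 0 y]
    ring
  rw [h1]
  exact ((hx 0).const_add (deriv f 0)).deriv

/-- `f ∈ H²_loc(ℝ)`: `f` is continuously differentiable and `f'` is locally absolutely continuous
(that is, the indefinite integral of its almost everywhere derivative `f''`), with
`f'' ∈ L²_loc`. -/
def MemH2Loc (f : ℝ → ℂ) : Prop :=
  ContDiff ℝ 1 f ∧ MemL2Loc (deriv (deriv f)) ∧
    ∀ a b : ℝ, deriv f b - deriv f a = ∫ x in a..b, deriv (deriv f) x

lemma MemH2Loc.of_integral {f g : ℝ → ℂ} (hf : ContDiff ℝ 1 f) (hg : MemL2Loc g)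
    (h : ∀ a b : ℝ, deriv f b - deriv f a = ∫ x in a..b, g x) : MemH2Loc f := by
  have hae := deriv_deriv_ae_eq hg.locallyIntegrable h
  refine ⟨hf, fun a b => (hg a b).ae_eq (ae_restrict_of_ae hae.symm), fun a b => ?_⟩
  rw [h a b]
  exact intervalIntegral.integral_congr_ae (by filter_upwards [hae] with x hx _ using hx.symm)

lemma MemL2Loc.intervalIntegrable {f : ℝ → ℂ} (hf : MemL2Loc f) (a b : ℝ) :
    IntervalIntegrable f volume a b :=
  ((hf.locallyIntegrable).integrableOn_isCompact isCompact_uIcc).intervalIntegrable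

lemma deriv_add_of_C1 {f g : ℝ → ℂ} (hf : ContDiff ℝ 1 f) (hg : ContDiff ℝ 1 g) :
    deriv (f + g) = deriv f + deriv g := by
  funext x
  exact deriv_add (hf.differentiable one_ne_zero x) (hg.differentiable one_ne_zero x)

lemma deriv_smul_fun (c : ℂ) (f : ℝ → ℂ) : deriv (c • f) = c • deriv f := by
  funext x
  rw [Pi.smul_apply, ← deriv_const_smul_field c f]

lemma MemH2Loc.integral_add {f g : ℝ → ℂ} (hf : MemH2Loc f) (hg : MemH2Loc g) (a b : ℝ) :
    deriv (f + g) b - deriv (f + g) a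
      = ∫ x in a..b, (deriv (deriv f) + deriv (deriv g)) x := by
  rw [deriv_add_of_C1 hf.1 hg.1]
  simp only [Pi.add_apply]
  rw [intervalIntegral.integral_add (hf.2.1.intervalIntegrable a b)
    (hg.2.1.intervalIntegrable a b), ← hf.2.2, ← hg.2.2]
  ring

lemma MemL2Loc.add {f g : ℝ → ℂ} (hf : MemL2Loc f) (hg : MemL2Loc g) : MemL2Loc (f + g) :=
  fun a b => (hf a b).add (hg a b)

lemma MemH2Loc.deriv_deriv_add {f g : ℝ → ℂ} (hf : MemH2Loc f) (hg : MemH2Loc g) :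
    deriv (deriv (f + g)) =ᵐ[volume] deriv (deriv f) + deriv (deriv g) :=
  deriv_deriv_ae_eq (hf.2.1.add hg.2.1).locallyIntegrable (hf.integral_add hg)

lemma MemH2Loc.add {f g : ℝ → ℂ} (hf : MemH2Loc f) (hg : MemH2Loc g) : MemH2Loc (f + g) :=
  .of_integral (hf.1.add hg.1) (hf.2.1.add hg.2.1) (hf.integral_add hg)

lemma MemH2Loc.smul {f : ℝ → ℂ} (c : ℂ) (hf : MemH2Loc f) : MemH2Loc (c • f) := by
  refine ⟨hf.1.const_smul c, ?_, fun a b => ?_⟩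
  · rw [deriv_smul_fun, deriv_smul_fun]
    exact fun a b => (hf.2.1 a b).const_smul c
  · rw [deriv_smul_fun, deriv_smul_fun]
    simp only [Pi.smul_apply]
    rw [intervalIntegral.integral_smul, ← hf.2.2, smul_sub]

lemma MemH2Loc.zero : MemH2Loc (0 : ℝ → ℂ) := by
  have h : deriv (0 : ℝ → ℂ) = 0 := by
    funext x
    exact deriv_const x (0 : ℂ)
  refine ⟨contDiff_const, ?_, ?_⟩
  · rw [h, h]
    exact fun _ _ => MemLp.zero
  · rw [h, h]
    simp

/-- The Sobolev space `H²_k` of `k`-pseudo-periodic `H²_loc` functions; its elements are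
represented by their continuously differentiable representatives. -/
def H2k (k : ℝ) : Submodule ℂ (ℝ → ℂ) where
  carrier := {f | MemH2Loc f ∧ ∀ x : ℝ, f (x + 1) = Complex.exp (Complex.I * k) * f x}
  zero_mem' := ⟨MemH2Loc.zero, by simp⟩
  add_mem' := by
    rintro f g ⟨hf, hf'⟩ ⟨hg, hg'⟩
    refine ⟨hf.add hg, fun x => ?_⟩
    simp only [Pi.add_apply, hf' x, hg' x, mul_add]
  smul_mem' := by
    rintro c f ⟨hf, hf'⟩
    refine ⟨hf.smul c, fun x => ?_⟩
    simp only [Pi.smul_apply, smul_eq_mul, hf' x]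
    ring

/-- The `m`-th Fourier coefficient of the one-periodic function `e^{-ikx} f(x)`. -/
def blochCoeff (k : ℝ) (f : ℝ → ℂ) (m : ℤ) : ℂ :=
  ∫ x in (0 : ℝ)..1, Complex.exp (-(Complex.I * (2 * Real.pi * m * x))) *
    (Complex.exp (-(Complex.I * (k * x))) * f x)

lemma blochCoeff_integrable (k : ℝ) {f : ℝ → ℂ} (hf : MemL2Loc f) (m : ℤ) :
    IntervalIntegrable (fun x : ℝ => Complex.exp (-(Complex.I * (2 * Real.pi * m * x))) *
      (Complex.exp (-(Complex.I * (k * x))) * f x)) volume 0 1 := by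
  have hc : ContinuousOn (fun x : ℝ => Complex.exp (-(Complex.I * (2 * Real.pi * m * x))) *
      Complex.exp (-(Complex.I * (k * x)))) (uIcc 0 1) := by fun_prop
  have h := (hf.intervalIntegrable 0 1).continuousOn_mul hc
  simpa only [mul_assoc] using h

/-- The subspace of `L²_k` of the functions `e^{ikx} ∑_{m ∈ S} p(m) e^{2πimx}` with
`∑ |p(m)|² < ∞`: the Fourier coefficients with index outside `S` vanish. -/
def L2kIndexed (k : ℝ) (S : Set ℤ) : Submodule ℂ (ℝ → ℂ) where
  carrier := {f | f ∈ L2k k ∧ ∀ m : ℤ, m ∉ S → blochCoeff k f m = 0}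
  zero_mem' := ⟨Submodule.zero_mem _, fun m _ => by simp [blochCoeff]⟩
  add_mem' := by
    rintro f g ⟨hf, hf'⟩ ⟨hg, hg'⟩
    refine ⟨Submodule.add_mem _ hf hg, fun m hm => ?_⟩
    have h := intervalIntegral.integral_add (blochCoeff_integrable k hf.1 m)
      (blochCoeff_integrable k hg.1 m)
    have h1 := hf' m hm
    have h2 := hg' m hm
    unfold blochCoeff at h1 h2 ⊢
    simp only [Pi.add_apply, mul_add]
    rw [h, h1, h2, add_zero]
  smul_mem' := by
    rintro c f ⟨hf, hf'⟩
    refine ⟨Submodule.smul_mem _ c hf, fun m hm => ?_⟩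
    have h1 := hf' m hm
    unfold blochCoeff at h1 ⊢
    simp only [Pi.smul_apply, smul_eq_mul, mul_left_comm _ c]
    rw [intervalIntegral.integral_const_mul, h1, mul_zero]

/-- `L²_{k,e}`: even-index Fourier series times `e^{ikx}`. -/
def L2kEven (k : ℝ) : Submodule ℂ (ℝ → ℂ) := L2kIndexed k {m | Even m}

/-- `L²_{k,o}`: odd-index Fourier series times `e^{ikx}`. -/
def L2kOdd (k : ℝ) : Submodule ℂ (ℝ → ℂ) := L2kIndexed k {m | Odd m}

/-- The inversion `(𝓘 f)(x) = f (-x)`. -/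
def inversion : (ℝ → ℂ) →ₗ[ℂ] (ℝ → ℂ) where
  toFun f := fun x => f (-x)
  map_add' _ _ := rfl
  map_smul' _ _ := rfl

/-- The Schrödinger operator `H = -∂ₓ² + Q`. On `H²_loc` the pointwise second derivative exists
almost everywhere and is the weak one, so `schrodinger Q f` is the usual element of `L²_loc`. -/
def schrodinger (Q : ℝ → ℝ) (f : ℝ → ℂ) : ℝ → ℂ :=
  fun x => -deriv (deriv f) x + (Q x : ℂ) * f x

/-- The `L²_k`-nullspace of `H - E`: all `f ∈ H²_k` with `H f = E f` in `L²_k`. -/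
def eigenspace (Q : ℝ → ℝ) (k E : ℝ) : Submodule ℂ (ℝ → ℂ) where
  carrier := {f | f ∈ H2k k ∧ schrodinger Q f =ᵐ[volume] fun x => (E : ℂ) * f x}
  zero_mem' := by
    refine ⟨Submodule.zero_mem _, ?_⟩
    have h : deriv (0 : ℝ → ℂ) = 0 := by
      funext x
      exact deriv_const x (0 : ℂ)
    refine Filter.Eventually.of_forall fun x => ?_
    simp only [schrodinger, h, Pi.zero_apply, mul_zero, neg_zero, add_zero]
  add_mem' := by
    rintro f g ⟨hf, hf'⟩ ⟨hg, hg'⟩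
    refine ⟨Submodule.add_mem _ hf hg, ?_⟩
    filter_upwards [hf', hg', hf.1.deriv_deriv_add hg.1] with x h1 h2 h3
    simp only [schrodinger] at h1 h2 ⊢
    rw [h3]
    simp only [Pi.add_apply]
    linear_combination h1 + h2
  smul_mem' := by
    rintro c f ⟨hf, hf'⟩
    refine ⟨Submodule.smul_mem _ c hf, ?_⟩
    filter_upwards [hf'] with x h1
    simp only [schrodinger, deriv_smul_fun, Pi.smul_apply, smul_eq_mul] at h1 ⊢
    linear_combination c * h1

/-- `E = E_b(k)`, the `b`-th eigenvalue (`b = 1, 2, …`) in the increasing list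
`E_1(k) ≤ E_2(k) ≤ ⋯` of the eigenvalues of `H` on `L²_k`, repeated by multiplicity: counted with
multiplicity, fewer than `b` eigenvalues are `< E`, and at least `b` are `≤ E`. (Eigenspaces to
distinct eigenvalues are independent, so the rank of their span is the sum of the
multiplicities.) -/
def IsBandEnergy (Q : ℝ → ℝ) (k : ℝ) (b : ℕ) (E : ℝ) : Prop :=
  Module.rank ℂ (⨆ μ ∈ Iio E, eigenspace Q k μ : Submodule ℂ (ℝ → ℂ)) < (b : Cardinal) ∧
    (b : Cardinal) ≤ Module.rank ℂ (⨆ μ ∈ Iic E, eigenspace Q k μ : Submodule ℂ (ℝ → ℂ))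

/-- `⟨f, g⟩ = ∫₀¹ conj f · g`. -/
def inner01 (f g : ℝ → ℂ) : ℂ :=
  ∫ x in (0 : ℝ)..1, (starRingEnd ℂ) (f x) * g x

/-- A family `k ↦ (Φ(·;k), E(k))`, `k ∈ J`, of Floquet–Bloch eigenpairs of `H = -∂ₓ² + Q`. -/
def IsFloquetBlochFamily (Q : ℝ → ℝ) (J : Set ℝ) (Φ : ℝ → ℝ → ℂ) (E : ℝ → ℝ) : Prop :=
  ∀ k ∈ J, Φ k ≠ 0 ∧ Φ k ∈ eigenspace Q k (E k)

/-- `(kstar, Estar)` is a Dirac point (linear band crossing of Dirac type) of `H = -∂ₓ² + Q`, with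
symmetry `S` and decomposition `H²_k = H²_A ⊕ H²_B`, where `H²_A = L²_A ∩ H²_k` and
`H²_B = L²_B ∩ H²_k`. -/
structure IsDiracPoint (Q : ℝ → ℝ) (kstar Estar : ℝ) (LA LB : Submodule ℂ (ℝ → ℂ))
    (S : (ℝ → ℂ) →ₗ[ℂ] (ℝ → ℂ)) : Prop where
  /-- The quasi-momentum lies in the Brillouin zone `[0, 2π]`. -/
  mem_brillouin : kstar ∈ Icc 0 (2 * Real.pi)
  /-- `Estar` is the common value of two consecutive bands at `kstar`. -/
  consecutive_bands : ∃ b : ℕ, 1 ≤ b ∧ IsBandEnergy Q kstar b Estar ∧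
    IsBandEnergy Q kstar (b + 1) Estar
  /-- `Estar` is an `L²_k`-eigenvalue of multiplicity two. -/
  multiplicity_two : Module.finrank ℂ (eigenspace Q kstar Estar) = 2
  LA_le : LA ≤ L2k kstar
  LB_le : LB ≤ L2k kstar
  /-- `H²_k = H²_A ⊕ H²_B`. -/
  disjoint : Disjoint (LA ⊓ H2k kstar) (LB ⊓ H2k kstar)
  sup_eq : (LA ⊓ H2k kstar) ⊔ (LB ⊓ H2k kstar) = H2k kstar
  /-- `H : H²_A → L²_A` and `H : H²_B → L²_B`. -/
  maps_A : ∀ f ∈ LA ⊓ H2k kstar, schrodinger Q f ∈ LA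
  maps_B : ∀ f ∈ LB ⊓ H2k kstar, schrodinger Q f ∈ LB
  /-- `S` acts on functions modulo null sets, exchanges `H²_A` and `H²_B`, is an involution and
  commutes with `H`. -/
  S_ae : ∀ f g : ℝ → ℂ, f =ᵐ[volume] g → S f =ᵐ[volume] S g
  S_maps_A : ∀ f ∈ LA ⊓ H2k kstar, S f ∈ LB ⊓ H2k kstar
  S_maps_B : ∀ f ∈ LB ⊓ H2k kstar, S f ∈ LA ⊓ H2k kstar
  S_involutive : ∀ f ∈ H2k kstar, S (S f) = f
  S_commutes : ∀ f ∈ H2k kstar, schrodinger Q (S f) =ᵐ[volume] S (schrodinger Q f)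
  /-- The nullspace of `H - Estar` has an orthonormal basis `Φ₁ ∈ H²_A`, `Φ₂ = S Φ₁`. -/
  exists_basis : ∃ Φ₁ ∈ LA ⊓ H2k kstar,
    Submodule.span ℂ {Φ₁, S Φ₁} = eigenspace Q kstar Estar ∧
    inner01 Φ₁ Φ₁ = 1 ∧ inner01 (S Φ₁) (S Φ₁) = 1 ∧
    inner01 Φ₁ (S Φ₁) = 0 ∧ inner01 (S Φ₁) Φ₁ = 0
  /-- Two smooth branches of Floquet–Bloch eigenvalues cross linearly, with slopes `±lam`. -/
  linear_crossing : ∃ lam : ℝ, lam ≠ 0 ∧ ∃ ζ₀ : ℝ, 0 < ζ₀ ∧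
    ∃ (Φp Φm : ℝ → ℝ → ℂ) (Ep Em ηp ηm : ℝ → ℝ),
      IsFloquetBlochFamily Q (Ioo (kstar - ζ₀) (kstar + ζ₀)) Φp Ep ∧
      IsFloquetBlochFamily Q (Ioo (kstar - ζ₀) (kstar + ζ₀)) Φm Em ∧
      ContDiffOn ℝ ∞ ηp (Ioo (-ζ₀) ζ₀) ∧ ηp 0 = 0 ∧
      ContDiffOn ℝ ∞ ηm (Ioo (-ζ₀) ζ₀) ∧ ηm 0 = 0 ∧
      (∀ k ∈ Ioo (kstar - ζ₀) (kstar + ζ₀),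
        Ep k - Estar = lam * (k - kstar) * (1 + ηp (k - kstar))) ∧
      (∀ k ∈ Ioo (kstar - ζ₀) (kstar + ζ₀),
        Em k - Estar = -lam * (k - kstar) * (1 + ηm (k - kstar)))

/-- `V` is a real even-index cosine series `V(x) = ∑_{p ∈ {0, 2, 4, …}} v_p cos(2πpx)` (written
with `p = 2j`) whose coefficients are absolutely summable. Every `C¹` even-index cosine series is
of this kind. -/
def IsEvenIndexCosineSeries (V : ℝ → ℝ) : Prop :=
  ∃ v : ℕ → ℝ, Summable (fun j => |v j|) ∧
    ∀ x : ℝ, HasSum (fun j : ℕ => v j * Real.cos (2 * Real.pi * (2 * j) * x)) (V x)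

end Hill

end

/-! An even-index cosine series is even and has period 1/2, so everything is governed by the half
translation `T y = y (· + 1/2)` on the two-dimensional solution space of `y'' = (εV - E) y`. The
Wronskian gives `T` determinant 1 and evenness gives it trace `D = 2 c (1/2)`, with `c` the
cosine-type solution; hence `T² - D T + 1 = 0` (`IsSol.translate_add_translate`).

At `k = π` the Floquet condition is `T² f = -f`, that is `D T f = 0`. So an energy is an eigenvalue
exactly when `D = 0`, and then every solution qualifies: multiplicity two is automatic. On `H²_π`
the even- and odd-index subspaces are the eigenspaces `T = i` and `T = -i`, and inversion exchanges
them because it conjugates `T` to its inverse.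

For `k` near `π`, the condition `D = ±2 cos (k/2)` gives `T` the eigenvalue `±e^{ik/2}`, whose
square is `e^{ik}`. If `g` is a local analytic inverse of `E ↦ D`, the two branches are `g (±2 cos
(k/2))`; as `cos (k/2)` has a simple zero at `π` and `D ∘ g = id` forces `g' (0) ≠ 0`, they cross
with opposite nonzero slopes.

For `ε = 0`, `D = 2 cos (√E / 2)` has simple zeros at the stated energies (`free_crossing`). Since
`D` is analytic in the potential, the implicit function theorem solves `D (ε, E) = d` by an analytic
`G (ε, d)` (`exists_analytic_implicit`); the Dirac energy is `G (ε, 0)`, and `g = G (ε, ·)`. -/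

noncomputable section

namespace Hill

open scoped BoundedContinuousFunction

/-! ### The Volterra equation in a cosh-weighted space -/

/-- The double primitive of `g` that vanishes to first order at `0`. -/
def doublePrimitive (g : ℝ → ℝ) (x : ℝ) : ℝ := ∫ t in (0 : ℝ)..x, ∫ s in (0 : ℝ)..t, g s

lemma hasDerivAt_primitive {g : ℝ → ℝ} (hg : Continuous g) (x : ℝ) :
    HasDerivAt (fun x => ∫ t in (0 : ℝ)..x, g t) (g x) x :=
  intervalIntegral.integral_hasDerivAt_right (hg.intervalIntegrable _ _)
    (hg.stronglyMeasurableAtFilter _ _) hg.continuousAt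

lemma continuous_primitive {g : ℝ → ℝ} (hg : Continuous g) :
    Continuous fun x => ∫ t in (0 : ℝ)..x, g t :=
  continuous_iff_continuousAt.2 fun x => (hasDerivAt_primitive hg x).continuousAt

lemma hasDerivAt_doublePrimitive {g : ℝ → ℝ} (hg : Continuous g) (x : ℝ) :
    HasDerivAt (doublePrimitive g) (∫ t in (0 : ℝ)..x, g t) x :=
  hasDerivAt_primitive (continuous_primitive hg) x

lemma continuous_doublePrimitive {g : ℝ → ℝ} (hg : Continuous g) :
    Continuous (doublePrimitive g) :=
  continuous_iff_continuousAt.2 fun x => (hasDerivAt_doublePrimitive hg x).continuousAt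

lemma doublePrimitive_add {f g : ℝ → ℝ} (hf : Continuous f) (hg : Continuous g) (x : ℝ) :
    doublePrimitive (fun t => f t + g t) x = doublePrimitive f x + doublePrimitive g x := by
  unfold doublePrimitive
  rw [← intervalIntegral.integral_add ((continuous_primitive hf).intervalIntegrable _ _)
    ((continuous_primitive hg).intervalIntegrable _ _)]
  congr 1
  funext t
  exact intervalIntegral.integral_add (hf.intervalIntegrable _ _) (hg.intervalIntegrable _ _)

lemma doublePrimitive_const_mul (c : ℝ) (g : ℝ → ℝ) (x : ℝ) :
    doublePrimitive (fun t => c * g t) x = c * doublePrimitive g x := by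
  simp only [doublePrimitive, intervalIntegral.integral_const_mul]

lemma hasDerivAt_cosh_mul (l x : ℝ) :
    HasDerivAt (fun t => Real.cosh (l * t)) (l * Real.sinh (l * x)) x := by
  have h := (Real.hasDerivAt_cosh (l * x)).comp x ((hasDerivAt_id x).const_mul l)
  simpa [Function.comp_def, mul_comm] using h

lemma hasDerivAt_sinh_mul (l x : ℝ) :
    HasDerivAt (fun t => Real.sinh (l * t)) (l * Real.cosh (l * x)) x := by
  have h := (Real.hasDerivAt_sinh (l * x)).comp x ((hasDerivAt_id x).const_mul l)
  simpa [Function.comp_def, mul_comm] using h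

lemma integral_cosh_mul {l : ℝ} (hl : 0 < l) (x : ℝ) :
    ∫ t in (0 : ℝ)..x, Real.cosh (l * t) = Real.sinh (l * x) / l := by
  rw [intervalIntegral.integral_eq_sub_of_hasDerivAt (f := fun t => Real.sinh (l * t) / l)]
  · simp
  · intro t _
    have h := (hasDerivAt_sinh_mul l t).div_const l
    rwa [mul_div_cancel_left₀ _ hl.ne'] at h
  · exact Continuous.intervalIntegrable (by fun_prop) _ _

lemma integral_sinh_mul {l : ℝ} (hl : 0 < l) (x : ℝ) :
    ∫ t in (0 : ℝ)..x, Real.sinh (l * t) = (Real.cosh (l * x) - 1) / l := by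
  rw [intervalIntegral.integral_eq_sub_of_hasDerivAt (f := fun t => Real.cosh (l * t) / l)]
  · simp [sub_div]
  · intro t _
    have h := (hasDerivAt_cosh_mul l t).div_const l
    rwa [mul_div_cancel_left₀ _ hl.ne'] at h
  · exact Continuous.intervalIntegrable (by fun_prop) _ _

lemma abs_primitive_le {l : ℝ} (hl : 0 < l) {g : ℝ → ℝ} {M : ℝ}
    (hM : ∀ t, |g t| ≤ M * Real.cosh (l * t)) (x : ℝ) :
    |∫ t in (0 : ℝ)..x, g t| ≤ |M / l * Real.sinh (l * x)| := by
  have h := intervalIntegral.norm_integral_le_abs_of_norm_le (a := 0) (b := x) (μ := volume)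
    (f := g) (g := fun t => M * Real.cosh (l * t))
    (Filter.Eventually.of_forall fun t => hM t)
    (Continuous.intervalIntegrable (by fun_prop) _ _)
  rw [intervalIntegral.integral_const_mul, integral_cosh_mul hl] at h
  rw [Real.norm_eq_abs] at h
  convert h using 2
  ring

/-- The double primitive of `cosh (l t)` is `(cosh (l x) - 1) / l²`, so double integration gains
`l⁻²` against this weight, uniformly on the line. A large `l` makes the Volterra operator a
contraction. -/
lemma abs_doublePrimitive_le {l : ℝ} (hl : 0 < l) {g : ℝ → ℝ} {M : ℝ}
    (hM : ∀ t, |g t| ≤ M * Real.cosh (l * t)) (x : ℝ) :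
    |doublePrimitive g x| ≤ M / l ^ 2 * Real.cosh (l * x) := by
  have hM0 : 0 ≤ M := by
    have := (abs_nonneg _).trans (hM 0)
    simpa using this
  have key : |doublePrimitive g x| ≤ |∫ t in (0 : ℝ)..x, M / l * Real.sinh (l * t)| := by
    change ‖∫ t in (0 : ℝ)..x, ∫ s in (0 : ℝ)..t, g s‖ ≤ _
    rcases le_total 0 x with hx | hx
    · refine intervalIntegral.norm_integral_le_abs_of_norm_le
        (g := fun t => M / l * Real.sinh (l * t))
        ((ae_restrict_iff' measurableSet_uIoc).2 (Filter.Eventually.of_forall fun t ht => ?_))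
        (Continuous.intervalIntegrable (by fun_prop) _ _)
      rw [uIoc_of_le hx] at ht
      refine (abs_primitive_le hl hM t).trans_eq (abs_of_nonneg ?_)
      exact mul_nonneg (by positivity) (Real.sinh_nonneg_iff.2 (mul_nonneg hl.le ht.1.le))
    -- For `x ≤ 0` the bound on the inner primitive is `-(M / l) sinh`, hence the change of sign.
    · rw [← abs_neg (∫ t in (0 : ℝ)..x, M / l * Real.sinh (l * t)),
        ← intervalIntegral.integral_neg]
      refine intervalIntegral.norm_integral_le_abs_of_norm_le
        (g := fun t => -(M / l * Real.sinh (l * t)))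
        ((ae_restrict_iff' measurableSet_uIoc).2 (Filter.Eventually.of_forall fun t ht => ?_))
        (Continuous.intervalIntegrable (by fun_prop) _ _)
      rw [uIoc_of_ge hx] at ht
      refine (abs_primitive_le hl hM t).trans_eq (abs_of_nonpos ?_)
      exact mul_nonpos_of_nonneg_of_nonpos (by positivity)
        (Real.sinh_nonpos_iff.2 (mul_nonpos_of_nonneg_of_nonpos hl.le ht.2))
  refine key.trans ?_
  rw [intervalIntegral.integral_const_mul, integral_sinh_mul hl, abs_of_nonneg]
  · have : M / l * ((Real.cosh (l * x) - 1) / l) = M / l ^ 2 * (Real.cosh (l * x) - 1) := by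
      field_simp
    rw [this]
    exact mul_le_mul_of_nonneg_left (by linarith) (by positivity)
  · have := Real.one_le_cosh (l * x)
    exact mul_nonneg (by positivity) (div_nonneg (by linarith) hl.le)

lemma abs_cosh_mul_apply_le (l : ℝ) (z : ℝ →ᵇ ℝ) (t : ℝ) :
    |Real.cosh (l * t) * z t| ≤ ‖z‖ * Real.cosh (l * t) := by
  rw [abs_mul, abs_of_pos (Real.cosh_pos _), mul_comm]
  exact mul_le_mul_of_nonneg_right (z.norm_coe_le_norm t) (Real.cosh_pos _).le

lemma continuous_cosh_mul_apply (l : ℝ) (z : ℝ →ᵇ ℝ) :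
    Continuous fun t => Real.cosh (l * t) * z t := by
  have := z.continuous
  fun_prop

/-- The double primitive, conjugated by the weight `cosh (l x)`, as a bounded function. -/
def weightedPrimitive {l : ℝ} (hl : 0 < l) (z : ℝ →ᵇ ℝ) : ℝ →ᵇ ℝ :=
  BoundedContinuousFunction.ofNormedAddCommGroup
    (fun x => (Real.cosh (l * x))⁻¹ * doublePrimitive (fun t => Real.cosh (l * t) * z t) x)
    (by
      have h1 := continuous_doublePrimitive (continuous_cosh_mul_apply l z)
      have h2 : Continuous fun x => (Real.cosh (l * x))⁻¹ :=
        Continuous.inv₀ (by fun_prop) fun x => (Real.cosh_pos _).ne'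
      exact h2.mul h1)
    (‖z‖ / l ^ 2)
    (by
      intro x
      have h := abs_doublePrimitive_le hl (abs_cosh_mul_apply_le l z) x
      have hc := Real.cosh_pos (l * x)
      rw [norm_mul, norm_inv, Real.norm_eq_abs, Real.norm_eq_abs, abs_of_pos hc, inv_mul_le_iff₀ hc,
        mul_comm]
      exact h)

lemma weightedPrimitive_apply {l : ℝ} (hl : 0 < l) (z : ℝ →ᵇ ℝ) (x : ℝ) :
    weightedPrimitive hl z x
      = (Real.cosh (l * x))⁻¹ * doublePrimitive (fun t => Real.cosh (l * t) * z t) x := rfl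

lemma norm_weightedPrimitive_le {l : ℝ} (hl : 0 < l) (z : ℝ →ᵇ ℝ) :
    ‖weightedPrimitive hl z‖ ≤ 1 / l ^ 2 * ‖z‖ := by
  have := BoundedContinuousFunction.norm_ofNormedAddCommGroup_le
    (f := fun x => (Real.cosh (l * x))⁻¹ * doublePrimitive (fun t => Real.cosh (l * t) * z t) x)
    (weightedPrimitive hl z).continuous (C := ‖z‖ / l ^ 2) (by positivity)
    (fun x => by
      have h := abs_doublePrimitive_le hl (abs_cosh_mul_apply_le l z) x
      have hc := Real.cosh_pos (l * x)
      rw [norm_mul, norm_inv, Real.norm_eq_abs, Real.norm_eq_abs, abs_of_pos hc, inv_mul_le_iff₀ hc,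
        mul_comm]
      exact h)
  calc ‖weightedPrimitive hl z‖ ≤ ‖z‖ / l ^ 2 := this
    _ = 1 / l ^ 2 * ‖z‖ := by ring

/-- `weightedPrimitive` as a bounded operator. -/
def weightedPrimitiveL {l : ℝ} (hl : 0 < l) : (ℝ →ᵇ ℝ) →L[ℝ] (ℝ →ᵇ ℝ) :=
  LinearMap.mkContinuous
    { toFun := weightedPrimitive hl
      map_add' := fun f g => by
        ext x
        simp only [weightedPrimitive_apply, BoundedContinuousFunction.coe_add, Pi.add_apply,
          mul_add]
        rw [doublePrimitive_add (continuous_cosh_mul_apply l f) (continuous_cosh_mul_apply l g),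
          mul_add]
      map_smul' := fun c f => by
        ext x
        simp only [weightedPrimitive_apply, BoundedContinuousFunction.coe_smul, smul_eq_mul,
          RingHom.id_apply, mul_left_comm _ c]
        rw [doublePrimitive_const_mul]
        ring }
    (1 / l ^ 2) (norm_weightedPrimitive_le hl)

/-- The Volterra operator of `y'' = q y` in the weighted space. -/
def volterra {l : ℝ} (hl : 0 < l) (q : ℝ →ᵇ ℝ) : (ℝ →ᵇ ℝ) →L[ℝ] (ℝ →ᵇ ℝ) :=
  weightedPrimitiveL hl ∘L ContinuousLinearMap.mul ℝ (ℝ →ᵇ ℝ) q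

lemma norm_volterra_le {l : ℝ} (hl : 0 < l) (q : ℝ →ᵇ ℝ) : ‖volterra hl q‖ ≤ ‖q‖ / l ^ 2 := by
  have h1 : ‖weightedPrimitiveL hl‖ ≤ 1 / l ^ 2 :=
    LinearMap.mkContinuous_norm_le _ (by positivity) _
  have h2 : ‖ContinuousLinearMap.mul ℝ (ℝ →ᵇ ℝ) q‖ ≤ ‖q‖ :=
    ContinuousLinearMap.opNorm_mul_apply_le ℝ (ℝ →ᵇ ℝ) q
  calc ‖volterra hl q‖ ≤ ‖weightedPrimitiveL hl‖ * ‖ContinuousLinearMap.mul ℝ (ℝ →ᵇ ℝ) q‖ :=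
        ContinuousLinearMap.opNorm_comp_le _ _
    _ ≤ 1 / l ^ 2 * ‖q‖ := mul_le_mul h1 h2 (norm_nonneg _) (by positivity)
    _ = ‖q‖ / l ^ 2 := by ring

lemma isUnit_one_sub_volterra {l : ℝ} (hl : 0 < l) {q : ℝ →ᵇ ℝ} (hq : ‖q‖ < l ^ 2) :
    IsUnit (1 - volterra hl q) := by
  refine isUnit_one_sub_of_norm_lt_one (R := (ℝ →ᵇ ℝ) →L[ℝ] (ℝ →ᵇ ℝ))
    ((norm_volterra_le hl q).trans_lt ?_)
  rwa [div_lt_one (by positivity)]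

/-- The solution of `y = cosh (l x) z₀ + ∫₀ˣ ∫₀ᵗ q y`. -/
def volterraSol {l : ℝ} (hl : 0 < l) (z₀ q : ℝ →ᵇ ℝ) (x : ℝ) : ℝ :=
  Real.cosh (l * x) * Ring.inverse (1 - volterra hl q) z₀ x

/-- `Ring.inverse` is a genuine inverse only at units; `hq` guarantees this by the Neumann series.
-/
lemma volterraSol_eq {l : ℝ} (hl : 0 < l) (z₀ : ℝ →ᵇ ℝ) {q : ℝ →ᵇ ℝ} (hq : ‖q‖ < l ^ 2) (x : ℝ) :
    volterraSol hl z₀ q x = Real.cosh (l * x) * z₀ x +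
      doublePrimitive (fun t => q t * volterraSol hl z₀ q t) x := by
  have h := Ring.mul_inverse_cancel _ (isUnit_one_sub_volterra hl hq)
  have h1 := DFunLike.congr_fun (DFunLike.congr_fun h z₀) x
  have hc := (Real.cosh_pos (l * x)).ne'
  have e : (fun t => q t * volterraSol hl z₀ q t) =
      fun t => Real.cosh (l * t) * (q * Ring.inverse (1 - volterra hl q) z₀) t := by
    funext t
    simp only [volterraSol, BoundedContinuousFunction.mul_apply]
    ring
  rw [e]
  simp only [mul_apply_eq_comp, sub_apply,
    one_apply_eq_self, BoundedContinuousFunction.sub_apply] at h1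
  have h2 : volterra hl q (Ring.inverse (1 - volterra hl q) z₀) x = (Real.cosh (l * x))⁻¹ *
      doublePrimitive (fun t => Real.cosh (l * t) *
        (q * Ring.inverse (1 - volterra hl q) z₀) t) x := rfl
  rw [h2] at h1
  rw [← h1, volterraSol]
  field_simp
  ring

lemma continuous_volterraSol {l : ℝ} (hl : 0 < l) (z₀ q : ℝ →ᵇ ℝ) :
    Continuous (volterraSol hl z₀ q) :=
  continuous_cosh_mul_apply l _

/-- A composition of an affine continuous map in `q`, inversion in a Banach algebra (analytic at
units), and a continuous linear functional. -/
lemma analyticAt_inverse_one_sub_comp {A X : Type*} [NormedAddCommGroup A] [NormedSpace ℝ A]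
    [NormedAddCommGroup X] [NormedSpace ℝ X] [CompleteSpace X] (K : X →L[ℝ] X)
    (m : A →L[ℝ] X →L[ℝ] X) (z : X) (ev : X →L[ℝ] ℝ) {q : A} (hq : IsUnit (1 - K ∘L m q)) :
    AnalyticAt ℝ (fun q => ev (Ring.inverse (1 - K ∘L m q) z)) q := by
  obtain ⟨u, hu⟩ := hq
  let T : A →L[ℝ] X →L[ℝ] X := (ContinuousLinearMap.compL ℝ X X X K) ∘L m
  have hT : AnalyticAt ℝ (fun q => T q) q := ContinuousLinearMap.analyticAt T q
  have h1 : AnalyticAt ℝ (fun q => 1 - K ∘L m q) q := analyticAt_const.sub hT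
  have h2 : AnalyticAt ℝ (fun q => Ring.inverse (1 - K ∘L m q)) q := by
    have := analyticAt_inverse (𝕜 := ℝ) u
    rw [hu] at this
    exact AnalyticAt.comp (f := fun q => 1 - K ∘L m q) this h1
  let L : (X →L[ℝ] X) →L[ℝ] ℝ := ev ∘L ContinuousLinearMap.apply ℝ X z
  exact AnalyticAt.comp (f := fun q => Ring.inverse (1 - K ∘L m q)) (L.analyticAt _) h2

lemma analyticAt_volterraSol {l : ℝ} (hl : 0 < l) (z₀ : ℝ →ᵇ ℝ) {q : ℝ →ᵇ ℝ} (hq : ‖q‖ < l ^ 2)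
    (x : ℝ) : AnalyticAt ℝ (fun q => volterraSol hl z₀ q x) q :=
  analyticAt_const.mul (analyticAt_inverse_one_sub_comp (weightedPrimitiveL hl)
    (ContinuousLinearMap.mul ℝ (ℝ →ᵇ ℝ)) z₀ (BoundedContinuousFunction.evalCLM ℝ x)
    (isUnit_one_sub_volterra hl hq))

/-! ### Classical solutions: symmetries and uniqueness -/

/-- Classical solutions of `y'' = q y`. -/
def IsSol (q : ℝ → ℝ) (y : ℝ → ℂ) : Prop :=
  Differentiable ℝ y ∧ ∀ x, HasDerivAt (deriv y) ((q x : ℂ) * y x) x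

lemma IsSol.of_hasDerivAt {q : ℝ → ℝ} {y y' : ℝ → ℂ} (h : ∀ x, HasDerivAt y (y' x) x)
    (h' : ∀ x, HasDerivAt y' ((q x : ℂ) * y x) x) : IsSol q y := by
  refine ⟨fun x => (h x).differentiableAt, ?_⟩
  have : deriv y = y' := funext fun x => (h x).deriv
  rwa [this]

lemma IsSol.hasDerivAt {q : ℝ → ℝ} {y : ℝ → ℂ} (h : IsSol q y) (x : ℝ) :
    HasDerivAt y (deriv y x) x := (h.1 x).hasDerivAt

lemma IsSol.continuous {q : ℝ → ℝ} {y : ℝ → ℂ} (h : IsSol q y) : Continuous y := h.1.continuous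

lemma IsSol.add {q : ℝ → ℝ} {y z : ℝ → ℂ} (hy : IsSol q y) (hz : IsSol q z) :
    IsSol q (fun x => y x + z x) :=
  .of_hasDerivAt (fun x => (hy.hasDerivAt x).add (hz.hasDerivAt x)) fun x => by
    have := (hy.2 x).add (hz.2 x)
    rwa [← mul_add] at this

lemma IsSol.const_mul {q : ℝ → ℝ} {y : ℝ → ℂ} (c : ℂ) (hy : IsSol q y) :
    IsSol q (fun x => c * y x) :=
  .of_hasDerivAt (fun x => (hy.hasDerivAt x).const_mul c) fun x => by
    have := (hy.2 x).const_mul c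
    rwa [mul_left_comm] at this

lemma IsSol.sub {q : ℝ → ℝ} {y z : ℝ → ℂ} (hy : IsSol q y) (hz : IsSol q z) :
    IsSol q (fun x => y x - z x) :=
  .of_hasDerivAt (fun x => (hy.hasDerivAt x).sub (hz.hasDerivAt x)) fun x => by
    have := (hy.2 x).sub (hz.2 x)
    rwa [← mul_sub] at this

lemma IsSol.comp_add_const {q : ℝ → ℝ} {y : ℝ → ℂ} (hy : IsSol q y) {a : ℝ}
    (hq : ∀ x, q (x + a) = q x) : IsSol q (fun x => y (x + a)) :=
  .of_hasDerivAt (fun x => (hy.hasDerivAt (x + a)).comp_add_const x a) fun x => by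
    have := (hy.2 (x + a)).comp_add_const x a
    rwa [hq] at this

lemma IsSol.comp_neg {q : ℝ → ℝ} {y : ℝ → ℂ} (hy : IsSol q y)
    (hq : ∀ x, q (-x) = q x) : IsSol q (fun x => y (-x)) :=
  .of_hasDerivAt (y' := fun x => -deriv y (-x))
    (fun x => by
      simpa [Function.comp_def] using (hy.hasDerivAt (-x)).scomp x (hasDerivAt_neg x)) fun x => by
    have := ((hy.2 (-x)).scomp x (hasDerivAt_neg x)).fun_neg
    simpa [hq, Function.comp_def] using this

/-- Boundedness of `q` makes the first-order system for `(y, y')` Lipschitz with a constant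
independent of time, so the solution through the origin is unique. -/
lemma IsSol.eq_zero {q : ℝ →ᵇ ℝ} {y : ℝ → ℂ} (hy : IsSol q y) {a : ℝ} (h0 : y a = 0)
    (h1 : deriv y a = 0) : y = 0 := by
  have hlip : ∀ t : ℝ, LipschitzOnWith (max 1 ‖q‖₊)
      (fun p : ℂ × ℂ => (p.2, (q t : ℂ) * p.1)) univ := by
    intro t
    refine LipschitzWith.lipschitzOnWith (LipschitzWith.of_dist_le_mul fun p r => ?_)
    rw [Prod.dist_eq, Prod.dist_eq]
    have hq : ‖q t‖ ≤ ‖q‖ := q.norm_coe_le_norm t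
    have e : dist ((q t : ℂ) * p.1) ((q t : ℂ) * r.1) = ‖q t‖ * dist p.1 r.1 := by
      rw [dist_eq_norm, ← mul_sub, norm_mul, dist_eq_norm, Complex.norm_real]
    have hc : ((max 1 ‖q‖₊ : NNReal) : ℝ) = max 1 ‖q‖ := by simp
    rw [hc]
    refine max_le ?_ ?_
    · calc dist p.2 r.2 ≤ max (dist p.1 r.1) (dist p.2 r.2) := le_max_right _ _
        _ = 1 * max (dist p.1 r.1) (dist p.2 r.2) := (one_mul _).symm
        _ ≤ _ := mul_le_mul_of_nonneg_right (le_max_left _ _)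
          (dist_nonneg.trans (le_max_left _ _))
    · rw [e]
      exact mul_le_mul (hq.trans (le_max_right _ _)) (le_max_left _ _) dist_nonneg
        (zero_le_one.trans (le_max_left _ _))
  have h := ODE_solution_unique_univ (t₀ := a) (f := fun t => (y t, deriv y t))
    (g := fun _ => ((0 : ℂ), (0 : ℂ))) hlip
    (fun t => ⟨(hy.hasDerivAt t).prodMk (hy.2 t), mem_univ _⟩)
    (fun t => ⟨(hasDerivAt_const t ((0 : ℂ), (0 : ℂ))).congr_deriv
      (by simp [Prod.ext_iff]), mem_univ _⟩)
    (by simp [h0, h1])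
  funext x
  exact congrArg Prod.fst (congrFun h x)

lemma IsSol.ext {q : ℝ →ᵇ ℝ} {y z : ℝ → ℂ} (hy : IsSol q y) (hz : IsSol q z) {a : ℝ}
    (h0 : y a = z a) (h1 : deriv y a = deriv z a) : y = z := by
  have h := (hy.sub hz).eq_zero (a := a) (by simp [h0])
    (by rw [((hy.hasDerivAt a).fun_sub (hz.hasDerivAt a)).deriv, h1, sub_self])
  funext x
  exact sub_eq_zero.1 (congrFun h x)

/-! ### Solutions with prescribed Cauchy data, and their analyticity in the potential -/

lemma abs_le_cosh (y : ℝ) : |y| ≤ Real.cosh y := by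
  rw [← Real.cosh_abs]
  exact (Real.self_le_sinh_iff.2 (abs_nonneg y)).trans (Real.sinh_lt_cosh _).le

/-- `x ↦ (α + β x) / cosh (l x)` as a bounded function. -/
def affineDivCosh {l : ℝ} (hl : 0 < l) (α β : ℝ) : ℝ →ᵇ ℝ :=
  BoundedContinuousFunction.ofNormedAddCommGroup
    (fun x => (α + β * x) * (Real.cosh (l * x))⁻¹)
    (by
      have h2 : Continuous fun x => (Real.cosh (l * x))⁻¹ :=
        Continuous.inv₀ (by fun_prop) fun x => (Real.cosh_pos _).ne'
      fun_prop)
    (|α| + |β| / l)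
    (by
      intro x
      have hc := Real.cosh_pos (l * x)
      rw [norm_mul, norm_inv, Real.norm_eq_abs, Real.norm_eq_abs, abs_of_pos hc,
        mul_inv_le_iff₀ hc]
      have h1 := abs_le_cosh (l * x)
      rw [abs_mul, abs_of_pos hl] at h1
      have h2 : |x| ≤ Real.cosh (l * x) / l := by rwa [le_div_iff₀ hl, mul_comm]
      calc |α + β * x| ≤ |α| + |β * x| := abs_add_le _ _
        _ = |α| * 1 + |β| * |x| := by rw [abs_mul, mul_one]
        _ ≤ |α| * Real.cosh (l * x) + |β| * (Real.cosh (l * x) / l) := by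
          gcongr
          exact Real.one_le_cosh _
        _ = _ := by ring)

lemma cosh_mul_affineDivCosh {l : ℝ} (hl : 0 < l) (α β x : ℝ) :
    Real.cosh (l * x) * affineDivCosh hl α β x = α + β * x := by
  change Real.cosh (l * x) * ((α + β * x) * (Real.cosh (l * x))⁻¹) = _
  have := (Real.cosh_pos (l * x)).ne'
  field_simp

lemma hasDerivAt_volterraSol {l : ℝ} (hl : 0 < l) (α β : ℝ) {q : ℝ →ᵇ ℝ} (hq : ‖q‖ < l ^ 2)
    (x : ℝ) : HasDerivAt (volterraSol hl (affineDivCosh hl α β) q)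
      (β + ∫ t in (0 : ℝ)..x, q t * volterraSol hl (affineDivCosh hl α β) q t) x := by
  have e : volterraSol hl (affineDivCosh hl α β) q = fun x => (α + β * x) +
      doublePrimitive (fun t => q t * volterraSol hl (affineDivCosh hl α β) q t) x := by
    funext x
    rw [← cosh_mul_affineDivCosh hl]
    exact volterraSol_eq hl _ hq x
  have hc : Continuous fun t => q t * volterraSol hl (affineDivCosh hl α β) q t :=
    q.continuous.mul (continuous_volterraSol hl _ _)
  have h := ((((hasDerivAt_id x).const_mul β).const_add α).add (hasDerivAt_doublePrimitive hc x))
  rw [mul_one] at h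
  exact h.congr_of_eventuallyEq (Filter.Eventually.of_forall fun t => congrFun e t)

lemma isSol_volterraSol {l : ℝ} (hl : 0 < l) (α β : ℝ) {q : ℝ →ᵇ ℝ} (hq : ‖q‖ < l ^ 2) :
    IsSol q (fun x => (volterraSol hl (affineDivCosh hl α β) q x : ℂ)) :=
  .of_hasDerivAt (fun x => (hasDerivAt_volterraSol hl α β hq x).ofReal_comp) fun x => by
    have hc : Continuous fun t => q t * volterraSol hl (affineDivCosh hl α β) q t :=
      q.continuous.mul (continuous_volterraSol hl _ _)
    have := ((hasDerivAt_primitive hc x).const_add β).ofReal_comp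
    simpa using this

lemma volterraSol_zero {l : ℝ} (hl : 0 < l) (α β : ℝ) {q : ℝ →ᵇ ℝ} (hq : ‖q‖ < l ^ 2) :
    volterraSol hl (affineDivCosh hl α β) q 0 = α := by
  rw [volterraSol_eq hl _ hq, cosh_mul_affineDivCosh]
  simp [doublePrimitive]

lemma deriv_volterraSol_zero {l : ℝ} (hl : 0 < l) (α β : ℝ) {q : ℝ →ᵇ ℝ} (hq : ‖q‖ < l ^ 2) :
    deriv (fun x => (volterraSol hl (affineDivCosh hl α β) q x : ℂ)) 0 = β := by
  rw [(hasDerivAt_volterraSol hl α β hq 0).ofReal_comp.deriv]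
  simp

lemma norm_lt_norm_add_one_sq (q : ℝ →ᵇ ℝ) : ‖q‖ < (‖q‖ + 1) ^ 2 := by
  nlinarith [norm_nonneg q]

lemma norm_add_one_pos (q : ℝ →ᵇ ℝ) : 0 < ‖q‖ + 1 := by positivity

/-- The real solution of `y'' = q y` with `y 0 = α` and `y' 0 = β`. -/
def realSol (α β : ℝ) (q : ℝ →ᵇ ℝ) : ℝ → ℝ :=
  volterraSol (norm_add_one_pos q) (affineDivCosh (norm_add_one_pos q) α β) q

lemma isSol_realSol (α β : ℝ) (q : ℝ →ᵇ ℝ) : IsSol q (fun x => (realSol α β q x : ℂ)) :=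
  isSol_volterraSol (norm_add_one_pos q) α β (norm_lt_norm_add_one_sq q)

lemma realSol_zero (α β : ℝ) (q : ℝ →ᵇ ℝ) : realSol α β q 0 = α :=
  volterraSol_zero (norm_add_one_pos q) α β (norm_lt_norm_add_one_sq q)

lemma deriv_realSol_zero (α β : ℝ) (q : ℝ →ᵇ ℝ) :
    deriv (fun x => (realSol α β q x : ℂ)) 0 = β :=
  deriv_volterraSol_zero (norm_add_one_pos q) α β (norm_lt_norm_add_one_sq q)

/-- The weight in `realSol` varies with `q`, but by uniqueness the solution does not depend on it.
This allows `l` to be frozen near a given potential, where analyticity can be read off. -/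
lemma realSol_eq_volterraSol {l : ℝ} (hl : 0 < l) (α β : ℝ) {q : ℝ →ᵇ ℝ} (hq : ‖q‖ < l ^ 2)
    (x : ℝ) : realSol α β q x = volterraSol hl (affineDivCosh hl α β) q x := by
  have h := (isSol_realSol α β q).ext (isSol_volterraSol hl α β hq) (a := 0)
    (by rw [realSol_zero, volterraSol_zero hl α β hq])
    (by rw [deriv_realSol_zero, deriv_volterraSol_zero hl α β hq])
  exact_mod_cast congrFun h x

lemma analyticAt_realSol (α β x : ℝ) (q : ℝ →ᵇ ℝ) :
    AnalyticAt ℝ (fun q => realSol α β q x) q := by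
  have hl : 0 < ‖q‖ + 1 := by positivity
  refine (analyticAt_volterraSol hl (affineDivCosh hl α β) (norm_lt_norm_add_one_sq q) x).congr ?_
  have : ∀ᶠ p : ℝ →ᵇ ℝ in nhds q, ‖p‖ < (‖q‖ + 1) ^ 2 :=
    continuous_norm.continuousAt.eventually_lt continuousAt_const (norm_lt_norm_add_one_sq q)
  filter_upwards [this] with p hp
  exact (realSol_eq_volterraSol hl α β hp x).symm

/-- Every solution is determined by its Cauchy data at `0`. -/
lemma IsSol.eq_fundamental {q : ℝ →ᵇ ℝ} {y : ℝ → ℂ} (hy : IsSol q y) :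
    y = fun x => y 0 * realSol 1 0 q x + deriv y 0 * realSol 0 1 q x := by
  have h1 := isSol_realSol 1 0 q
  have h2 := isSol_realSol 0 1 q
  refine hy.ext (a := 0) ((h1.const_mul _).add (h2.const_mul _)) ?_ ?_
  · simp [realSol_zero]
  · rw [(((h1.hasDerivAt 0).const_mul (y 0)).fun_add
      ((h2.hasDerivAt 0).const_mul (deriv y 0))).deriv, deriv_realSol_zero, deriv_realSol_zero]
    simp

/-! ### The discriminant and the half-period monodromy -/

/-- The Hill discriminant of an even potential of period `1/2`. -/
def discriminant (q : ℝ →ᵇ ℝ) : ℝ := 2 * realSol 1 0 q (1 / 2)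

lemma analyticAt_discriminant (q : ℝ →ᵇ ℝ) : AnalyticAt ℝ discriminant q :=
  analyticAt_const.mul (analyticAt_realSol 1 0 (1 / 2) q)

/-- Two potentials are allowed: equal ones give a constant Wronskian, ones differing by a constant
give orthogonality of eigenfunctions. -/
lemma IsSol.hasDerivAt_wronskian {p q : ℝ → ℝ} {y z : ℝ → ℂ} (hy : IsSol p y) (hz : IsSol q z)
    (x : ℝ) : HasDerivAt (fun x => y x * deriv z x - deriv y x * z x)
      (((q x : ℂ) - p x) * (y x * z x)) x := by
  have := ((hy.hasDerivAt x).fun_mul (hz.2 x)).fun_sub ((hy.2 x).fun_mul (hz.hasDerivAt x))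
  exact this.congr_deriv (by ring)

lemma IsSol.wronskian_eq {q : ℝ → ℝ} {y z : ℝ → ℂ} (hy : IsSol q y) (hz : IsSol q z)
    (a b : ℝ) : y a * deriv z a - deriv y a * z a = y b * deriv z b - deriv y b * z b := by
  refine is_const_of_deriv_eq_zero (f := fun x => y x * deriv z x - deriv y x * z x)
    (fun x => (hy.hasDerivAt_wronskian hz x).differentiableAt) (fun x => ?_) a b
  rw [(hy.hasDerivAt_wronskian hz x).deriv]
  simp

/-- For an even potential of period `1/2`, translation by half a period has trace
`discriminant q` and determinant `1` on the solution space. -/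
lemma IsSol.translate_add_translate {q : ℝ →ᵇ ℝ} (hp : ∀ x, q (x + 1 / 2) = q x)
    (he : ∀ x, q (-x) = q x) {y : ℝ → ℂ} (hy : IsSol q y) (x : ℝ) :
    y (x + 1) + y x = discriminant q * y (x + 1 / 2) := by
  obtain ⟨c, hc⟩ : ∃ c : ℝ → ℂ, c = fun x => (realSol 1 0 q x : ℂ) := ⟨_, rfl⟩
  obtain ⟨s, hs⟩ : ∃ s : ℝ → ℂ, s = fun x => (realSol 0 1 q x : ℂ) := ⟨_, rfl⟩
  have hcS : IsSol q c := hc ▸ isSol_realSol 1 0 q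
  have hsS : IsSol q s := hs ▸ isSol_realSol 0 1 q
  have hc0 : c 0 = 1 := by simp [hc, realSol_zero]
  have hc0' : deriv c 0 = 0 := by rw [hc, deriv_realSol_zero]; simp
  have hs0 : s 0 = 0 := by simp [hs, realSol_zero]
  have hs0' : deriv s 0 = 1 := by rw [hs, deriv_realSol_zero]; simp
  have hD : (discriminant q : ℂ) = 2 * c (1 / 2) := by simp [discriminant, hc]
  have fund : ∀ y : ℝ → ℂ, IsSol q y → y = fun x => y 0 * c x + deriv y 0 * s x := by
    intro y hy
    rw [hc, hs]
    exact hy.eq_fundamental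
  have fund' : ∀ y : ℝ → ℂ, IsSol q y → ∀ x, deriv y x = y 0 * deriv c x + deriv y 0 * deriv s x := by
    intro y hy x
    conv_lhs => rw [fund y hy]
    exact (((hcS.hasDerivAt x).const_mul _).fun_add ((hsS.hasDerivAt x).const_mul _)).deriv
  -- A half translate is again a solution, with Cauchy data read at `1/2`.
  have shift : ∀ y : ℝ → ℂ, IsSol q y → ∀ x,
      y (x + 1 / 2) = y (1 / 2) * c x + deriv y (1 / 2) * s x ∧
      deriv y (x + 1 / 2) = y (1 / 2) * deriv c x + deriv y (1 / 2) * deriv s x := by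
    intro y hy x
    have h := hy.comp_add_const hp
    have h1 : deriv (fun x => y (x + 1 / 2)) = fun x => deriv y (x + 1 / 2) := by
      funext x
      exact deriv_comp_add_const ..
    have h2 := congrFun (fund _ h) x
    have h3 := fund' _ h x
    simp only [h1, zero_add] at h2 h3
    exact ⟨h2, h3⟩
  have cneg : ∀ x, c (-x) = c x ∧ deriv c (-x) = -deriv c x := by
    have h := hcS.comp_neg he
    have h1 : ∀ x, deriv (fun x => c (-x)) x = -deriv c (-x) := fun x => deriv_comp_neg ..
    have h2 : (fun x => c (-x)) = c := h.ext hcS (a := 0) (by simp) (by rw [h1]; simp [hc0'])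
    intro x
    rw [h2] at h1
    exact ⟨congrFun h2 x, by rw [h1 x, neg_neg]⟩
  have sneg : ∀ x, s (-x) = -s x ∧ deriv s (-x) = deriv s x := by
    have h := (hsS.comp_neg he).const_mul (-1)
    have h1 : ∀ x, deriv (fun x => -1 * s (-x)) x = deriv s (-x) := by
      intro x
      rw [deriv_const_mul_field, deriv_comp_neg]
      simp
    have h2 : (fun x => -1 * s (-x)) = s :=
      h.ext hsS (a := 0) (by simp [hs0]) (by rw [h1, neg_zero])
    intro x
    rw [h2] at h1
    refine ⟨?_, (h1 x).symm⟩
    have := congrFun h2 (-x)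
    simp only [neg_neg] at this
    rw [← this]
    simp
  have hw : c (1 / 2) * deriv s (1 / 2) - deriv c (1 / 2) * s (1 / 2) = 1 := by
    rw [hcS.wronskian_eq hsS (1 / 2) 0, hc0, hc0', hs0']
    simp
  -- Evenness enters here: translating `s` from `-1/2` to `0` and reflecting gives two relations
  -- which, with the Wronskian, force equal diagonal entries of the half-period matrix. Its trace is
  -- thus `2 c (1/2)`.
  have hcs : c (1 / 2) = deriv s (1 / 2) := by
    obtain ⟨h3, h4⟩ := shift s hsS (-(1 / 2))
    rw [neg_add_cancel, (sneg _).1, (cneg _).1, hs0] at h3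
    rw [neg_add_cancel, (sneg _).2, (cneg _).2, hs0'] at h4
    linear_combination c (1 / 2) * (h4 + hw) + deriv c (1 / 2) * h3 +
      (deriv s (1 / 2) - c (1 / 2)) * hw
  -- Cayley–Hamilton in coordinates, with `hw` as the determinant.
  obtain ⟨h1, -⟩ := shift y hy (x + 1 / 2)
  obtain ⟨h2, -⟩ := shift c hcS x
  obtain ⟨h3, -⟩ := shift s hsS x
  obtain ⟨h4, -⟩ := shift y hy x
  have h5 := congrFun (fund y hy) x
  have h6 := congrFun (fund y hy) (1 / 2)
  have h7 := fund' y hy (1 / 2)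
  rw [show x + 1 = (x + 1 / 2) + 1 / 2 by ring, h1, h4, h2, h3, h5, h6, h7, hD]
  rw [← hcs] at hw ⊢
  linear_combination (-(y 0 * c x + deriv y 0 * s x)) * hw

/-! ### Local Sobolev classes under translation and reflection -/

lemma _root_.Continuous.memL2Loc {f : ℝ → ℂ} (hf : Continuous f) : MemL2Loc f := by
  intro a b
  obtain ⟨C, hC⟩ := isCompact_Icc.exists_bound_of_continuousOn (s := Icc a b) hf.continuousOn
  exact MemLp.of_bound hf.aestronglyMeasurable C
    ((ae_restrict_iff' measurableSet_Icc).2 (Filter.Eventually.of_forall hC))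

lemma MemL2Loc.comp_measurePreserving {f : ℝ → ℂ} (hf : MemL2Loc f) {φ : ℝ → ℝ}
    (hφ : MeasurePreserving φ) (h : ∀ a b, ∃ c d, Icc a b = φ ⁻¹' Icc c d) :
    MemL2Loc (fun x => f (φ x)) := by
  intro a b
  obtain ⟨c, d, hcd⟩ := h a b
  rw [hcd]
  exact (hf c d).comp_measurePreserving (hφ.restrict_preimage measurableSet_Icc)

lemma MemL2Loc.comp_add_const {f : ℝ → ℂ} (hf : MemL2Loc f) (a : ℝ) :
    MemL2Loc (fun x => f (x + a)) :=
  hf.comp_measurePreserving (measurePreserving_add_right volume a) fun b c =>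
    ⟨b + a, c + a, by ext x; simp⟩

lemma MemL2Loc.comp_neg {f : ℝ → ℂ} (hf : MemL2Loc f) : MemL2Loc (fun x => f (-x)) :=
  hf.comp_measurePreserving (Measure.measurePreserving_neg volume) fun b c =>
    ⟨-c, -b, by ext x; simp⟩

lemma MemL2Loc.neg {f : ℝ → ℂ} (hf : MemL2Loc f) : MemL2Loc (fun x => -f x) :=
  fun a b => (hf a b).neg

lemma MemL2Loc.continuous_mul {f g : ℝ → ℂ} (hg : Continuous g) (hf : MemL2Loc f) :
    MemL2Loc (fun x => g x * f x) := by
  intro a b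
  obtain ⟨C, hC⟩ := isCompact_Icc.exists_bound_of_continuousOn (s := Icc a b) hg.continuousOn
  refine (hf a b).of_le_mul (c := C)
    (hg.aestronglyMeasurable.mul (hf a b).aestronglyMeasurable)
    ((ae_restrict_iff' measurableSet_Icc).2 (Filter.Eventually.of_forall fun x hx => ?_))
  rw [norm_mul]
  exact mul_le_mul_of_nonneg_right (hC x hx) (norm_nonneg _)

lemma MemH2Loc.comp_add_const {f : ℝ → ℂ} (hf : MemH2Loc f) (a : ℝ) :
    MemH2Loc (fun x => f (x + a)) := by
  have h1 : deriv (fun x => f (x + a)) = fun x => deriv f (x + a) :=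
    funext fun x => deriv_comp_add_const ..
  refine .of_integral (g := fun x => deriv (deriv f) (x + a))
    (hf.1.comp (contDiff_id.add contDiff_const)) (hf.2.1.comp_add_const a) fun b c => ?_
  rw [h1, intervalIntegral.integral_comp_add_right (fun x => deriv (deriv f) x), ← hf.2.2]

lemma MemH2Loc.comp_neg {f : ℝ → ℂ} (hf : MemH2Loc f) : MemH2Loc (fun x => f (-x)) := by
  have h1 : deriv (fun x => f (-x)) = fun x => -deriv f (-x) :=
    funext fun x => deriv_comp_neg ..
  refine .of_integral (g := fun x => deriv (deriv f) (-x))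
    (hf.1.comp contDiff_neg) hf.2.1.comp_neg fun b c => ?_
  rw [h1, intervalIntegral.integral_comp_neg (fun x => deriv (deriv f) x), ← hf.2.2]
  ring

/-! ### Index parity as an eigenvalue of the half translation -/

lemma exp_I_mul_pi : Complex.exp (Complex.I * (Real.pi : ℂ)) = -1 := by
  rw [mul_comm, Complex.exp_pi_mul_I]

lemma mem_H2k_pi {f : ℝ → ℂ} : f ∈ H2k Real.pi ↔ MemH2Loc f ∧ ∀ x, f (x + 1) = -f x := by
  change (_ ∧ _) ↔ _
  simp only [exp_I_mul_pi, neg_one_mul]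

lemma add_half_add_half {f : ℝ → ℂ} {c : ℂ} (h : ∀ x, f (x + 1 / 2) = c * f x) (x : ℝ) :
    f (x + 1) = c * c * f x := by
  rw [show x + 1 = x + 1 / 2 + 1 / 2 by ring, h, h, mul_assoc]

lemma integral_add_const_of_periodic {F : ℝ → ℂ} (hF : Function.Periodic F 1) (a : ℝ) :
    ∫ x in (0 : ℝ)..1, F (x + a) = ∫ x in (0 : ℝ)..1, F x := by
  rw [intervalIntegral.integral_comp_add_right, add_comm 1 a, zero_add,
    hF.intervalIntegral_add_eq a 0, zero_add]

/-- The half-period shift both preserves the integral and reverses its sign. This kills Fourier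
coefficients of the wrong parity and also yields the orthogonality of `Φ₁` and `Φ₂`. -/
lemma integral_eq_zero_of_antiperiodic {F : ℝ → ℂ} (hF : ∀ x, F (x + 1 / 2) = -F x) :
    ∫ x in (0 : ℝ)..1, F x = 0 := by
  have hp : Function.Periodic F 1 := fun x => by
    rw [add_half_add_half (f := F) (c := -1) (by simpa using hF)]
    simp
  have h := integral_add_const_of_periodic hp (1 / 2)
  simp only [hF, intervalIntegral.integral_neg] at h
  linear_combination (-1 / 2 : ℂ) * h

lemma exp_neg_I_pi_half : Complex.exp (-(Complex.I * (Real.pi * (1 / 2)))) = -Complex.I := by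
  rw [show -(Complex.I * (Real.pi * (1 / 2))) = -(Real.pi / 2 * Complex.I) by ring,
    Complex.exp_neg, Complex.exp_pi_div_two_mul_I, Complex.inv_I]

lemma exp_neg_I_pi_int (m : ℤ) : Complex.exp (-(Complex.I * (2 * Real.pi * m * (1 / 2)))) =
    (-1) ^ m := by
  rw [show -(Complex.I * (2 * Real.pi * m * (1 / 2))) = -((m : ℂ) * (Real.pi * Complex.I)) by ring,
    Complex.exp_neg, Complex.exp_int_mul, Complex.exp_pi_mul_I, ← inv_zpow]
  norm_num

/-- The integrand of `blochCoeff` picks up the factor `(-1)^m (-i)` under half a period. -/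
lemma blochCoeff_kernel_add_half (m : ℤ) (x : ℝ) (z : ℂ) :
    Complex.exp (-(Complex.I * (2 * Real.pi * m * ((x + 1 / 2 : ℝ) : ℂ)))) *
      (Complex.exp (-(Complex.I * (Real.pi * ((x + 1 / 2 : ℝ) : ℂ)))) * z) =
    (-1) ^ m * -Complex.I * (Complex.exp (-(Complex.I * (2 * Real.pi * m * x))) *
      (Complex.exp (-(Complex.I * (Real.pi * x))) * z)) := by
  rw [← exp_neg_I_pi_half, ← exp_neg_I_pi_int]
  simp only [← mul_assoc, ← Complex.exp_add]
  push_cast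
  congr 2
  ring

/-- `hm` says precisely that the integrand changes sign under a half period. -/
lemma blochCoeff_eq_zero {f : ℝ → ℂ} {c : ℂ} (h : ∀ x, f (x + 1 / 2) = c * f x) {m : ℤ}
    (hm : (-1) ^ m * -Complex.I * c = -1) : blochCoeff Real.pi f m = 0 := by
  refine integral_eq_zero_of_antiperiodic fun x => ?_
  rw [blochCoeff_kernel_add_half, h]
  linear_combination (Complex.exp (-(Complex.I * (2 * Real.pi * m * x))) *
      (Complex.exp (-(Complex.I * (Real.pi * x))) * f x)) * hm

/-- Antiperiodicity of `f` compensates that of `e^{-iπx}`, so the integrand has period 1 and its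
integral may be shifted. -/
lemma blochCoeff_comp_add_half {f : ℝ → ℂ} (h : ∀ x, f (x + 1) = -f x) (m : ℤ) :
    (-1) ^ m * -Complex.I * blochCoeff Real.pi (fun x => f (x + 1 / 2)) m =
      blochCoeff Real.pi f m := by
  unfold blochCoeff
  rw [← intervalIntegral.integral_const_mul]
  simp only [← blochCoeff_kernel_add_half]
  refine integral_add_const_of_periodic (F := fun x : ℝ =>
    Complex.exp (-(Complex.I * (2 * Real.pi * m * x))) *
      (Complex.exp (-(Complex.I * (Real.pi * x))) * f x)) (fun x => ?_) (1 / 2)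
  have e : ((-1 : ℂ) ^ m) * (-1) ^ m = 1 := by
    rw [← mul_zpow]
    simp
  simp only
  rw [show x + 1 = x + 1 / 2 + 1 / 2 by ring, blochCoeff_kernel_add_half,
    blochCoeff_kernel_add_half, show x + 1 / 2 + 1 / 2 = x + 1 by ring, h]
  linear_combination (Complex.exp (-(Complex.I * (2 * Real.pi * m * x))) *
      (Complex.exp (-(Complex.I * (Real.pi * x))) * f x)) * (e * (-Complex.I ^ 2) - Complex.I_sq)

/-- `e^{-iπx} g` descends to a continuous function on the circle. Its coefficients are all zero,
hence summable, so its Fourier series converges to it pointwise. -/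
lemma eq_zero_of_blochCoeff_eq_zero {g : ℝ → ℂ} (hc : Continuous g)
    (h : ∀ x, g (x + 1) = -g x) (h0 : ∀ m, blochCoeff Real.pi g m = 0) : g = 0 := by
  have : Fact ((0 : ℝ) < 1) := ⟨one_pos⟩
  have hp : Function.Periodic (fun x : ℝ => Complex.exp (-(Complex.I * (Real.pi * x))) * g x) 1 := by
    intro x
    simp only
    rw [h, show -(Complex.I * (Real.pi * ((x + 1 : ℝ) : ℂ))) =
      -(Complex.I * (Real.pi * x)) - Complex.I * Real.pi by push_cast; ring,
      Complex.exp_sub, exp_I_mul_pi]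
    ring
  let G : C(AddCircle (1 : ℝ), ℂ) :=
    ⟨hp.lift, continuous_coinduced_dom.2 (by
      change Continuous (fun x : ℝ => Complex.exp (-(Complex.I * (Real.pi * x))) * g x)
      fun_prop)⟩
  have hG : ∀ m, fourierCoeff G m = 0 := by
    intro m
    rw [fourierCoeff_eq_intervalIntegral _ _ 0]
    have := h0 m
    unfold blochCoeff at this
    rw [zero_add, ← this]
    simp only [div_one, one_smul]
    refine intervalIntegral.integral_congr fun x _ => ?_
    change fourier (-m) (x : AddCircle (1 : ℝ)) • (Complex.exp (-(Complex.I * (Real.pi * x))) * g x)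
      = _
    rw [fourier_coe_apply, smul_eq_mul]
    congr 2
    push_cast
    ring
  funext x
  have hs := has_pointwise_sum_fourier_series_of_summable (f := G)
    (by rw [show fourierCoeff G = 0 from funext hG]; exact summable_zero) (x : AddCircle (1 : ℝ))
  simp only [hG, zero_smul] at hs
  have := hs.unique hasSum_zero
  change Complex.exp (-(Complex.I * (Real.pi * x))) * g x = 0 at this
  simpa using this

lemma blochCoeff_sub_const_mul {k : ℝ} {f g : ℝ → ℂ} (hf : MemL2Loc f) (hg : MemL2Loc g) (c : ℂ)
    (m : ℤ) : blochCoeff k (fun x => f x - c * g x) m = blochCoeff k f m - c * blochCoeff k g m := by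
  have h := intervalIntegral.integral_sub (blochCoeff_integrable k hf m)
      ((blochCoeff_integrable k hg m).const_mul c)
  rw [intervalIntegral.integral_const_mul] at h
  unfold blochCoeff
  rw [← h]
  congr 1
  funext x
  ring

/-- The `m`-th coefficient of `f (· + 1/2) - c f` is `(-1)^m i - c` times that of `f`; the first
alternative in `h0` says that this factor vanishes. -/
lemma comp_add_half_of_blochCoeff {f : ℝ → ℂ} (hf : f ∈ H2k Real.pi) {c : ℂ}
    (h0 : ∀ m : ℤ, (-1) ^ m * -Complex.I * c = 1 ∨ blochCoeff Real.pi f m = 0) (x : ℝ) :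
    f (x + 1 / 2) = c * f x := by
  obtain ⟨hf, hf1⟩ := mem_H2k_pi.1 hf
  have hc := hf.1.continuous
  have h := eq_zero_of_blochCoeff_eq_zero (g := fun x => f (x + 1 / 2) - c * f x)
    (by fun_prop) (fun x => by
      rw [hf1, show x + 1 + 1 / 2 = x + 1 / 2 + 1 by ring, hf1]
      ring) (fun m => by
      rw [blochCoeff_sub_const_mul (hc.memL2Loc.comp_add_const _) hc.memL2Loc]
      have h1 := blochCoeff_comp_add_half hf1 m
      have e : ((-1 : ℂ) ^ m) * (-1) ^ m = 1 := by
        rw [← mul_zpow]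
        simp
      have h2 : blochCoeff Real.pi (fun x => f (x + 1 / 2)) m =
          (-1) ^ m * Complex.I * blochCoeff Real.pi f m := by
        rw [← h1]
        linear_combination blochCoeff Real.pi (fun x => f (x + 1 / 2)) m *
          (-e + (-1) ^ m * (-1) ^ m * Complex.I_sq)
      rcases h0 m with h3 | h3
      · rw [h2]
        linear_combination blochCoeff Real.pi f m *
          (-((-1) ^ m * Complex.I) * h3 + c * e - c * (-1) ^ m * (-1) ^ m * Complex.I_sq)
      · rw [h2, h3]
        simp)
  exact sub_eq_zero.1 (congrFun h x)

lemma mem_L2kEven_pi {f : ℝ → ℂ} (hf : MemL2Loc f) (h : ∀ x, f (x + 1 / 2) = Complex.I * f x) :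
    f ∈ L2kEven Real.pi := by
  refine ⟨⟨hf, Filter.Eventually.of_forall fun x => ?_⟩, fun m hm => blochCoeff_eq_zero h ?_⟩
  · rw [add_half_add_half h, Complex.I_mul_I, exp_I_mul_pi]
  · rw [(Int.not_even_iff_odd.1 hm).neg_one_zpow]
    linear_combination Complex.I_sq

lemma mem_L2kOdd_pi {f : ℝ → ℂ} (hf : MemL2Loc f) (h : ∀ x, f (x + 1 / 2) = -Complex.I * f x) :
    f ∈ L2kOdd Real.pi := by
  refine ⟨⟨hf, Filter.Eventually.of_forall fun x => ?_⟩, fun m hm => blochCoeff_eq_zero h ?_⟩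
  · rw [add_half_add_half h, neg_mul_neg, Complex.I_mul_I, exp_I_mul_pi]
  · rw [(Int.not_odd_iff_even.1 hm).neg_one_zpow]
    linear_combination Complex.I_sq

/-- A half translation multiplies `e^{iπx} e^{2πimx}` by `i (-1)^m`, so the parity of `m` is the
choice between `i` and `-i`. This replaces Fourier conditions by pointwise ones. -/
lemma mem_even_inf_H2k_pi {f : ℝ → ℂ} : f ∈ L2kEven Real.pi ⊓ H2k Real.pi ↔
    MemH2Loc f ∧ ∀ x, f (x + 1 / 2) = Complex.I * f x := by
  constructor
  · rintro ⟨h1, h2⟩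
    refine ⟨h2.1, comp_add_half_of_blochCoeff h2 fun m => ?_⟩
    rcases Int.even_or_odd m with hm | hm
    · left
      rw [hm.neg_one_zpow]
      linear_combination -Complex.I_sq
    · exact Or.inr (h1.2 m (Int.not_even_iff_odd.2 hm))
  · rintro ⟨h1, h2⟩
    refine ⟨mem_L2kEven_pi h1.1.continuous.memL2Loc h2, mem_H2k_pi.2 ⟨h1, fun x => ?_⟩⟩
    rw [add_half_add_half h2, Complex.I_mul_I, neg_one_mul]

lemma mem_odd_inf_H2k_pi {f : ℝ → ℂ} : f ∈ L2kOdd Real.pi ⊓ H2k Real.pi ↔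
    MemH2Loc f ∧ ∀ x, f (x + 1 / 2) = -Complex.I * f x := by
  constructor
  · rintro ⟨h1, h2⟩
    refine ⟨h2.1, comp_add_half_of_blochCoeff h2 fun m => ?_⟩
    rcases Int.even_or_odd m with hm | hm
    · exact Or.inr (h1.2 m (Int.not_odd_iff_even.2 hm))
    · left
      rw [hm.neg_one_zpow]
      linear_combination -Complex.I_sq
  · rintro ⟨h1, h2⟩
    refine ⟨mem_L2kOdd_pi h1.1.continuous.memL2Loc h2, mem_H2k_pi.2 ⟨h1, fun x => ?_⟩⟩
    rw [add_half_add_half h2, neg_mul_neg, Complex.I_mul_I, neg_one_mul]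

lemma disjoint_even_odd :
    Disjoint (L2kEven Real.pi ⊓ H2k Real.pi) (L2kOdd Real.pi ⊓ H2k Real.pi) := by
  rw [Submodule.disjoint_def]
  intro f h1 h2
  funext x
  have h3 := (mem_even_inf_H2k_pi.1 h1).2 x
  have h4 := (mem_odd_inf_H2k_pi.1 h2).2 x
  rw [h3] at h4
  have : (2 * Complex.I) * f x = 0 := by linear_combination h4
  simpa using this

/-- On `H²_π` one has `T² = -1`, so `(1 - iT)/2` and `(1 + iT)/2` are the projections onto `T = i`
and `T = -i`. -/
lemma even_sup_odd :
    (L2kEven Real.pi ⊓ H2k Real.pi) ⊔ (L2kOdd Real.pi ⊓ H2k Real.pi) = H2k Real.pi := by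
  refine le_antisymm (sup_le inf_le_right inf_le_right) fun f hf => ?_
  obtain ⟨h1, h2⟩ := mem_H2k_pi.1 hf
  have h3 := h1.comp_add_const (1 / 2)
  refine Submodule.mem_sup.2 ⟨(1 / 2 : ℂ) • (f + (-Complex.I) • fun x => f (x + 1 / 2)),
    mem_even_inf_H2k_pi.2 ⟨(h1.add (h3.smul _)).smul _, fun x => ?_⟩,
    (1 / 2 : ℂ) • (f + Complex.I • fun x => f (x + 1 / 2)),
    mem_odd_inf_H2k_pi.2 ⟨(h1.add (h3.smul _)).smul _, fun x => ?_⟩, ?_⟩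
  · simp only [Pi.smul_apply, Pi.add_apply, smul_eq_mul]
    rw [show x + 1 / 2 + 1 / 2 = x + 1 by ring, h2]
    linear_combination (1 / 2 * f (x + 1 / 2)) * Complex.I_sq
  · simp only [Pi.smul_apply, Pi.add_apply, smul_eq_mul]
    rw [show x + 1 / 2 + 1 / 2 = x + 1 by ring, h2]
    linear_combination (1 / 2 * f (x + 1 / 2)) * Complex.I_sq
  · funext x
    simp only [Pi.smul_apply, Pi.add_apply, smul_eq_mul]
    ring

lemma MemH2Loc.memL2Loc_schrodinger {Q : ℝ → ℝ} (hQ : Continuous Q) {f : ℝ → ℂ} (hf : MemH2Loc f) :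
    MemL2Loc (schrodinger Q f) :=
  hf.2.1.neg.add (MemL2Loc.continuous_mul (g := fun x => (Q x : ℂ)) (by fun_prop)
    hf.1.continuous.memL2Loc)

lemma schrodinger_comp_add_const {Q : ℝ → ℝ} {a : ℝ} (hQ : ∀ x, Q (x + a) = Q x) {f : ℝ → ℂ}
    {c : ℂ} (hf : ∀ x, f (x + a) = c * f x) (x : ℝ) :
    schrodinger Q f (x + a) = c * schrodinger Q f x := by
  have h1 : ∀ x, deriv f (x + a) = c * deriv f x := fun x => by
    rw [← deriv_comp_add_const, ← deriv_const_mul_field]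
    simp only [hf]
  have h2 : deriv (deriv f) (x + a) = c * deriv (deriv f) x := by
    rw [← deriv_comp_add_const, ← deriv_const_mul_field]
    simp only [h1]
  simp only [schrodinger, h2, hQ, hf]
  ring

lemma schrodinger_inversion {Q : ℝ → ℝ} (hQ : ∀ x, Q (-x) = Q x) (f : ℝ → ℂ) :
    schrodinger Q (inversion f) = inversion (schrodinger Q f) := by
  have h1 : deriv (inversion f) = fun x => -deriv f (-x) := funext fun x => deriv_comp_neg ..
  funext x
  have h2 : deriv (deriv (inversion f)) x = deriv (deriv f) (-x) := by
    rw [h1, deriv.fun_neg, deriv_comp_neg, neg_neg]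
  change -deriv (deriv (inversion f)) x + Q x * f (-x) =
    -deriv (deriv f) (-x) + Q (-x) * f (-x)
  rw [h2, hQ]

/-- Inversion conjugates the half translation into its inverse, so the multiplier `c` becomes `c⁻¹`,
and `i` and `-i` are swapped. -/
lemma inversion_comp_add_half {f : ℝ → ℂ} {c : ℂ} (h : ∀ x, f (x + 1 / 2) = c * f x) {d : ℂ}
    (hcd : d * c = 1) (x : ℝ) : inversion f (x + 1 / 2) = d * inversion f x := by
  have := h (-(x + 1 / 2))
  rw [show -(x + 1 / 2) + 1 / 2 = -x by ring] at this
  change f (-(x + 1 / 2)) = d * f (-x)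
  rw [this, ← mul_assoc, hcd, one_mul]

lemma inversion_mem_odd {f : ℝ → ℂ} (hf : f ∈ L2kEven Real.pi ⊓ H2k Real.pi) :
    inversion f ∈ L2kOdd Real.pi ⊓ H2k Real.pi := by
  obtain ⟨h1, h2⟩ := mem_even_inf_H2k_pi.1 hf
  exact mem_odd_inf_H2k_pi.2 ⟨h1.comp_neg, inversion_comp_add_half h2 (by simp)⟩

lemma inversion_mem_even {f : ℝ → ℂ} (hf : f ∈ L2kOdd Real.pi ⊓ H2k Real.pi) :
    inversion f ∈ L2kEven Real.pi ⊓ H2k Real.pi := by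
  obtain ⟨h1, h2⟩ := mem_odd_inf_H2k_pi.1 hf
  exact mem_even_inf_H2k_pi.2 ⟨h1.comp_neg, inversion_comp_add_half h2 (by simp)⟩

lemma inversion_ae_eq {f g : ℝ → ℂ} (h : f =ᵐ[volume] g) : inversion f =ᵐ[volume] inversion g :=
  (Measure.measurePreserving_neg (volume : Measure ℝ)).quasiMeasurePreserving.ae_eq_comp h

/-! ### Eigenspaces as spaces of classical solutions -/

lemma IsSol.continuous_deriv {q : ℝ → ℝ} {y : ℝ → ℂ} (h : IsSol q y) : Continuous (deriv y) :=
  continuous_iff_continuousAt.2 fun x => (h.2 x).continuousAt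

/-- The potential `W - E`. -/
def energyShift (W : ℝ →ᵇ ℝ) (E : ℝ) : ℝ →ᵇ ℝ := W - E • 1

lemma energyShift_apply (W : ℝ →ᵇ ℝ) (E x : ℝ) : energyShift W E x = W x - E := by
  simp [energyShift]

/-- Regularity: `f'' = (W - E) f` almost everywhere with continuous right side, so `f'` is the
primitive of a continuous function and the equation holds everywhere. -/
lemma mem_eigenspace_iff {W : ℝ →ᵇ ℝ} {k E : ℝ} {f : ℝ → ℂ} : f ∈ eigenspace W k E ↔
    IsSol (energyShift W E) f ∧ ∀ x, f (x + 1) = Complex.exp (Complex.I * k) * f x := by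
  have hW := W.continuous
  constructor
  · rintro ⟨⟨h1, h2⟩, h3⟩
    refine ⟨⟨h1.1.differentiable one_ne_zero, fun x => ?_⟩, h2⟩
    have hf := h1.1.continuous
    have hc : Continuous fun t => (((energyShift W E) t : ℝ) : ℂ) * f t := by
      have := (energyShift W E).continuous
      fun_prop
    have e : deriv f = fun y => deriv f 0 +
        ∫ t in (0 : ℝ)..y, (((energyShift W E) t : ℝ) : ℂ) * f t := by
      funext y
      rw [← sub_eq_iff_eq_add', h1.2.2]
      refine intervalIntegral.integral_congr_ae ?_
      filter_upwards [h3] with t ht _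
      simp only [schrodinger] at ht
      simp only [energyShift_apply, Complex.ofReal_sub]
      linear_combination -ht
    rw [e]
    exact (intervalIntegral.integral_hasDerivAt_right (hc.intervalIntegrable _ _)
      (hc.stronglyMeasurableAtFilter _ _) hc.continuousAt).const_add _
  · rintro ⟨h1, h2⟩
    have hc : Continuous fun t => (((energyShift W E) t : ℝ) : ℂ) * f t := by
      have := (energyShift W E).continuous
      have := h1.continuous
      fun_prop
    refine ⟨⟨.of_integral (contDiff_one_iff_deriv.2 ⟨h1.1, h1.continuous_deriv⟩) hc.memL2Loc
      fun a b => ?_, h2⟩, Filter.Eventually.of_forall fun x => ?_⟩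
    · exact (intervalIntegral.integral_eq_sub_of_hasDerivAt (fun x _ => h1.2 x)
        (hc.intervalIntegrable _ _)).symm
    · simp only [schrodinger, (h1.2 x).deriv]
      simp only [energyShift_apply, Complex.ofReal_sub]
      ring

lemma mem_eigenspace_pi_iff {W : ℝ →ᵇ ℝ} {E : ℝ} {f : ℝ → ℂ} : f ∈ eigenspace W Real.pi E ↔
    IsSol (energyShift W E) f ∧ ∀ x, f (x + 1) = -f x := by
  rw [mem_eigenspace_iff]
  simp only [exp_I_mul_pi, neg_one_mul]

lemma deriv_antiperiodic {f : ℝ → ℂ} (h : ∀ x, f (x + 1) = -f x) (x : ℝ) :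
    deriv f (x + 1) = -deriv f x := by
  rw [← deriv_comp_add_const, ← deriv.fun_neg]
  simp only [h]

lemma exists_ne_zero_mem_Icc {f : ℝ → ℂ} (h : ∀ x, f (x + 1) = -f x) (h0 : f ≠ 0) :
    ∃ x ∈ Icc (0 : ℝ) 1, f x ≠ 0 := by
  obtain ⟨x, hx⟩ := Function.ne_iff.1 h0
  have hp : Function.Periodic (fun x => ‖f x‖) 1 := fun x => by simp [h]
  obtain ⟨y, hy, hxy⟩ := hp.exists_mem_Ico₀ one_pos x
  refine ⟨y, ⟨hy.1, hy.2.le⟩, ?_⟩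
  rw [← norm_ne_zero_iff, ← hxy]
  exact norm_ne_zero_iff.2 hx

lemma inner01_self_pos {f : ℝ → ℂ} (hc : Continuous f) (h : ∀ x, f (x + 1) = -f x) (h0 : f ≠ 0) :
    ∃ r : ℝ, 0 < r ∧ inner01 f f = r := by
  refine ⟨∫ x in (0 : ℝ)..1, ‖f x‖ ^ 2, ?_, ?_⟩
  · obtain ⟨x, hx, hfx⟩ := exists_ne_zero_mem_Icc h h0
    refine intervalIntegral.integral_pos one_pos (by fun_prop) (fun _ _ => by positivity)
      ⟨x, hx, by positivity⟩
  · rw [inner01, ← intervalIntegral.integral_ofReal]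
    congr 1
    funext x
    rw [mul_comm, Complex.mul_conj']
    push_cast
    rfl

lemma IsSol.conj {q : ℝ → ℝ} {f : ℝ → ℂ} (hf : IsSol q f) :
    IsSol q (fun x => (starRingEnd ℂ) (f x)) :=
  .of_hasDerivAt (fun x => (hf.hasDerivAt x).star) fun x => by
    have := (hf.2 x).star
    simpa using this

/-- Integrate the derivative of the Wronskian of `conj f` and `g`: the boundary terms cancel since
all four factors change sign over a period. -/
lemma inner01_eigenspace_eq_zero {W : ℝ →ᵇ ℝ} {E F : ℝ} (hEF : E ≠ F) {f g : ℝ → ℂ}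
    (hf : f ∈ eigenspace W Real.pi E) (hg : g ∈ eigenspace W Real.pi F) : inner01 f g = 0 := by
  obtain ⟨hf, hf1⟩ := mem_eigenspace_pi_iff.1 hf
  obtain ⟨hg, hg1⟩ := mem_eigenspace_pi_iff.1 hg
  have hw := hf.conj.hasDerivAt_wronskian hg
  have hcf := hf.continuous
  have hcg := hg.continuous
  have hi := intervalIntegral.integral_eq_sub_of_hasDerivAt (a := 0) (b := 1) (fun x _ => hw x)
    (Continuous.intervalIntegrable (by
      have h1 := (energyShift W E).continuous
      have h2 := (energyShift W F).continuous
      fun_prop) _ _)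
  have h1 := deriv_antiperiodic (f := fun x => (starRingEnd ℂ) (f x)) (by simp [hf1]) 0
  have h2 := deriv_antiperiodic hg1 0
  have h3 := hf1 0
  have h4 := hg1 0
  rw [zero_add] at h1 h2 h3 h4
  rw [h1, h2, h3, h4] at hi
  have e : ∀ x, ((((energyShift W F) x : ℝ) : ℂ) - ((energyShift W E) x : ℝ)) *
      ((starRingEnd ℂ) (f x) * g x) = ((E : ℂ) - F) * ((starRingEnd ℂ) (f x) * g x) := by
    intro x
    simp only [energyShift_apply, Complex.ofReal_sub]
    ring
  simp only [e, intervalIntegral.integral_const_mul] at hi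
  have hne : (E : ℂ) - F ≠ 0 := sub_ne_zero.2 (by exact_mod_cast hEF)
  refine (mul_eq_zero.1 (?_ : ((E : ℂ) - F) * inner01 f g = 0)).resolve_left hne
  unfold inner01
  rw [hi, map_neg]
  ring

/-- Energy identity: integrating `(conj f · f')'` gives `∫ (|f'|² + (W - E)|f|²) = 0`, while `W - E
> 0`. -/
lemma eigenspace_pi_eq_bot_of_lt {W : ℝ →ᵇ ℝ} {E : ℝ} (hE : E < -‖W‖) :
    eigenspace W Real.pi E = ⊥ := by
  rw [Submodule.eq_bot_iff]
  intro f hf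
  obtain ⟨hf, hf1⟩ := mem_eigenspace_pi_iff.1 hf
  by_contra h0
  obtain ⟨x₀, hx₀, hfx⟩ := exists_ne_zero_mem_Icc hf1 h0
  have hq : ∀ x, 0 < (energyShift W E) x := fun x => by
    have := (abs_le.1 (W.norm_coe_le_norm x)).1
    simp only [energyShift_apply]
    linarith
  set q := energyShift W E with hqdef
  have hcf := hf.continuous
  have hcd := hf.continuous_deriv
  have hcq := q.continuous
  have hd : ∀ x, HasDerivAt (fun x => (starRingEnd ℂ) (f x) * deriv f x)
      (((‖deriv f x‖ ^ 2 + q x * ‖f x‖ ^ 2 : ℝ) : ℂ)) x := fun x => by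
    refine (((hf.hasDerivAt x).star).fun_mul (hf.2 x)).congr_deriv ?_
    have h1 := Complex.conj_mul' (f x)
    have h2 := Complex.conj_mul' (deriv f x)
    push_cast
    rw [← h1, ← h2]
    change (starRingEnd ℂ) (deriv f x) * deriv f x + (starRingEnd ℂ) (f x) * _ = _
    ring
  have hi := intervalIntegral.integral_eq_sub_of_hasDerivAt (a := 0) (b := 1) (fun x _ => hd x)
    (Continuous.intervalIntegrable (by fun_prop) _ _)
  have h2 := deriv_antiperiodic hf1 0
  have h3 := hf1 0
  rw [zero_add] at h2 h3
  rw [h2, h3, map_neg, neg_mul_neg, sub_self, intervalIntegral.integral_ofReal] at hi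
  have hpos : 0 < ∫ x in (0 : ℝ)..1, (‖deriv f x‖ ^ 2 + q x * ‖f x‖ ^ 2) := by
    refine intervalIntegral.integral_pos one_pos (by fun_prop) (fun x _ => ?_) ⟨x₀, hx₀, ?_⟩
    · have := hq x
      positivity
    · have := hq x₀
      positivity
  exact hpos.ne' (by exact_mod_cast hi)

lemma eigenspace_le_span (W : ℝ →ᵇ ℝ) (k E : ℝ) : eigenspace W k E ≤ Submodule.span ℂ
    {(fun x => (realSol 1 0 (energyShift W E) x : ℂ)),
      (fun x => (realSol 0 1 (energyShift W E) x : ℂ))} := by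
  intro f hf
  rw [IsSol.eq_fundamental (y := f) (mem_eigenspace_iff.1 hf).1]
  exact Submodule.mem_span_pair.2 ⟨f 0, deriv f 0, rfl⟩

instance finiteDimensional_eigenspace (W : ℝ →ᵇ ℝ) (k E : ℝ) :
    FiniteDimensional ℂ (eigenspace W k E) := by
  have : FiniteDimensional ℂ (Submodule.span ℂ
    {(fun x => (realSol 1 0 (energyShift W E) x : ℂ)),
      (fun x => (realSol 0 1 (energyShift W E) x : ℂ))}) :=
    FiniteDimensional.span_of_finite ℂ (by simp)
  exact Submodule.finiteDimensional_of_le (eigenspace_le_span W k E)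

lemma disjoint_iSup_eigenspace (W : ℝ →ᵇ ℝ) (E : ℝ) :
    Disjoint (⨆ μ ∈ Iio E, eigenspace W Real.pi μ) (eigenspace W Real.pi E) := by
  rw [Submodule.disjoint_def]
  intro f hfA hfE
  obtain ⟨hf, hf1⟩ := mem_eigenspace_pi_iff.1 hfE
  have hcf := hf.continuous
  -- The continuous functions orthogonal to `f`; continuity makes the integral additive. All lower
  -- eigenspaces lie in `N`, so `f` would be orthogonal to itself.
  let N : Submodule ℂ (ℝ → ℂ) :=
    { carrier := {g | Continuous g ∧ inner01 f g = 0}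
      zero_mem' := ⟨continuous_zero, by simp [inner01]⟩
      add_mem' := by
        rintro g h ⟨hg, hg'⟩ ⟨hh, hh'⟩
        refine ⟨hg.add hh, ?_⟩
        unfold inner01 at *
        simp only [Pi.add_apply, mul_add]
        rw [intervalIntegral.integral_add, hg', hh', add_zero]
        all_goals exact Continuous.intervalIntegrable (by fun_prop) _ _
      smul_mem' := by
        rintro c g ⟨hg, hg'⟩
        refine ⟨hg.const_smul c, ?_⟩
        unfold inner01 at *
        simp only [Pi.smul_apply, smul_eq_mul, mul_left_comm _ c]
        rw [intervalIntegral.integral_const_mul, hg', mul_zero] }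
  have hN : (⨆ μ ∈ Iio E, eigenspace W Real.pi μ) ≤ N := iSup₂_le fun μ hμ g hg =>
    ⟨(mem_eigenspace_iff.1 hg).1.continuous,
      inner01_eigenspace_eq_zero (ne_of_gt (mem_Iio.1 hμ)) hfE hg⟩
  by_contra h0
  obtain ⟨r, hr, hfr⟩ := inner01_self_pos hcf hf1 h0
  have := (hN hfA).2
  rw [hfr] at this
  exact hr.ne' (by exact_mod_cast this)

/-! ### Zeros of the discriminant and band counting at `k = π` -/

section HalfPeriodic

variable {W : ℝ →ᵇ ℝ}

lemma energyShift_add_half (hp : ∀ x, W (x + 1 / 2) = W x) (E x : ℝ) :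
    (energyShift W E) (x + 1 / 2) = (energyShift W E) x := by
  rw [energyShift_apply, energyShift_apply, hp]

lemma energyShift_neg (he : ∀ x, W (-x) = W x) (E x : ℝ) :
    (energyShift W E) (-x) = (energyShift W E) x := by
  rw [energyShift_apply, energyShift_apply, he]

/-- Antiperiodicity annihilates the left side of `IsSol.translate_add_translate`; evaluating at `x -
1/2` leaves `D · f x`. -/
lemma discriminant_eq_zero_of_mem_eigenspace (hp : ∀ x, W (x + 1 / 2) = W x)
    (he : ∀ x, W (-x) = W x) {E : ℝ} {f : ℝ → ℂ} (hf : f ∈ eigenspace W Real.pi E) (h0 : f ≠ 0) :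
    discriminant (energyShift W E) = 0 := by
  obtain ⟨hf, hf1⟩ := mem_eigenspace_pi_iff.1 hf
  obtain ⟨x, hx⟩ := Function.ne_iff.1 h0
  have h := hf.translate_add_translate (energyShift_add_half hp E) (energyShift_neg he E)
    (x - 1 / 2)
  rw [hf1, sub_add_cancel, neg_add_cancel] at h
  simpa using (mul_eq_zero.1 h.symm).resolve_right hx

lemma mem_eigenspace_of_discriminant_eq_zero (hp : ∀ x, W (x + 1 / 2) = W x)
    (he : ∀ x, W (-x) = W x) {E : ℝ} (hD : discriminant (energyShift W E) = 0)
    {f : ℝ → ℂ} (hf : IsSol (energyShift W E) f) : f ∈ eigenspace W Real.pi E := by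
  refine mem_eigenspace_pi_iff.2 ⟨hf, fun x => ?_⟩
  have h := hf.translate_add_translate (energyShift_add_half hp E) (energyShift_neg he E) x
  rw [hD] at h
  simp only [Complex.ofReal_zero, zero_mul] at h
  exact eq_neg_of_add_eq_zero_left h

lemma finrank_eigenspace_eq_two (hp : ∀ x, W (x + 1 / 2) = W x)
    (he : ∀ x, W (-x) = W x) {E : ℝ} (hD : discriminant (energyShift W E) = 0) :
    Module.finrank ℂ (eigenspace W Real.pi E) = 2 := by
  set q := energyShift W E with hq
  have h : eigenspace W Real.pi E = Submodule.span ℂ (Set.range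
      ![(fun x => (realSol 1 0 q x : ℂ)), (fun x => (realSol 0 1 q x : ℂ))]) := by
    refine le_antisymm ?_ (Submodule.span_le.2 ?_)
    · rw [Matrix.range_cons_cons_empty]
      exact eigenspace_le_span W _ E
    · rintro _ ⟨i, rfl⟩
      fin_cases i
      · exact mem_eigenspace_of_discriminant_eq_zero hp he hD (isSol_realSol 1 0 q)
      · exact mem_eigenspace_of_discriminant_eq_zero hp he hD (isSol_realSol 0 1 q)
  have hli : LinearIndependent ℂ
      ![(fun x => (realSol 1 0 q x : ℂ)), (fun x => (realSol 0 1 q x : ℂ))] := by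
    rw [LinearIndependent.pair_iff]
    intro a b hab
    have h1 := congrFun hab 0
    simp only [Pi.add_apply, Pi.smul_apply, realSol_zero, Pi.zero_apply, smul_eq_mul,
      Complex.ofReal_one, Complex.ofReal_zero, mul_one, mul_zero, add_zero] at h1
    refine ⟨h1, ?_⟩
    have h2 : deriv (fun x => b * (realSol 0 1 q x : ℂ)) 0 = 0 := by
      have e : (fun x => b * (realSol 0 1 q x : ℂ)) = fun _ => 0 := by
        funext x
        have := congrFun hab x
        simpa [h1] using this
      rw [e, deriv_const]
    rw [deriv_const_mul_field, deriv_realSol_zero] at h2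
    simpa using h2
  rw [h, finrank_span_eq_card hli, Fintype.card_fin]

lemma analyticAt_discriminant_sub (W : ℝ →ᵇ ℝ) (E : ℝ) :
    AnalyticAt ℝ (fun E : ℝ => discriminant (energyShift W E)) E :=
  AnalyticAt.comp (f := fun E : ℝ => energyShift W E) (analyticAt_discriminant _)
    (analyticAt_const.sub (analyticAt_id.smul analyticAt_const))

/-- Zeros below `-‖W‖` would give two-dimensional eigenspaces where there are none. An infinite set
of zeros would accumulate in `[-‖W‖, E]`, and the discriminant, analytic in the energy, would vanish
identically. -/
lemma finite_discriminant_zeros (hp : ∀ x, W (x + 1 / 2) = W x)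
    (he : ∀ x, W (-x) = W x) (E : ℝ) :
    {μ | μ ≤ E ∧ discriminant (energyShift W μ) = 0}.Finite := by
  have hlow : ∀ μ, μ < -‖W‖ → discriminant (energyShift W μ) ≠ 0 := by
    intro μ hμ h
    have h2 := finrank_eigenspace_eq_two hp he h
    rw [eigenspace_pi_eq_bot_of_lt hμ, finrank_bot] at h2
    exact absurd h2 (by norm_num)
  by_contra hinf
  obtain ⟨z, -, hz⟩ := Set.Infinite.exists_accPt_of_subset_isCompact (K := Icc (-‖W‖) E) hinf
    isCompact_Icc (fun μ hμ => ⟨not_lt.1 fun h => hlow μ h hμ.2, hμ.1⟩)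
  rw [accPt_iff_frequently_nhdsNE] at hz
  have h := AnalyticOnNhd.eqOn_zero_of_preconnected_of_frequently_eq_zero
    (fun μ _ => analyticAt_discriminant_sub W μ) isPreconnected_univ (mem_univ z)
    (hz.mono fun μ hμ => hμ.2)
  exact hlow (-‖W‖ - 1) (by linarith) (h (mem_univ _))

lemma finiteDimensional_iSup_eigenspace (hp : ∀ x, W (x + 1 / 2) = W x)
    (he : ∀ x, W (-x) = W x) (E : ℝ) :
    FiniteDimensional ℂ (⨆ μ ∈ Iio E, eigenspace W Real.pi μ : Submodule ℂ (ℝ → ℂ)) := by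
  have := (finite_discriminant_zeros hp he E).to_subtype
  have hle : (⨆ μ ∈ Iio E, eigenspace W Real.pi μ) ≤
      ⨆ μ : {μ | μ ≤ E ∧ discriminant (energyShift W μ) = 0}, eigenspace W Real.pi μ := by
    refine iSup₂_le fun μ hμ f hf => ?_
    by_cases h0 : f = 0
    · rw [h0]
      exact Submodule.zero_mem _
    · exact Submodule.mem_iSup_of_mem
        (⟨μ, (mem_Iio.1 hμ).le, discriminant_eq_zero_of_mem_eigenspace hp he hf h0⟩ :
          {μ | μ ≤ E ∧ discriminant (energyShift W μ) = 0}) hf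
  exact Submodule.finiteDimensional_of_le hle

lemma exists_isBandEnergy (hp : ∀ x, W (x + 1 / 2) = W x)
    (he : ∀ x, W (-x) = W x) {E : ℝ} (hD : discriminant (energyShift W E) = 0) :
    ∃ b : ℕ, 1 ≤ b ∧ IsBandEnergy W Real.pi b E ∧ IsBandEnergy W Real.pi (b + 1) E := by
  have hfd := finiteDimensional_iSup_eigenspace hp he E
  set A : Submodule ℂ (ℝ → ℂ) := ⨆ μ ∈ Iio E, eigenspace W Real.pi μ with hA
  have hle : A ⊔ eigenspace W Real.pi E ≤ ⨆ μ ∈ Iic E, eigenspace W Real.pi μ := by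
    refine sup_le (biSup_mono fun μ hμ => ?_) ?_
    · exact mem_Iic.2 (mem_Iio.1 hμ).le
    · exact le_biSup (fun μ => eigenspace W Real.pi μ) (mem_Iic.2 le_rfl)
  have hrank := Submodule.finrank_sup_add_finrank_inf_eq A (eigenspace W Real.pi E)
  rw [(disjoint_iSup_eigenspace W E).eq_bot, finrank_bot, add_zero,
    finrank_eigenspace_eq_two hp he hD] at hrank
  have hup : ((Module.finrank ℂ A + 2 : ℕ) : Cardinal) ≤
      Module.rank ℂ (⨆ μ ∈ Iic E, eigenspace W Real.pi μ : Submodule ℂ (ℝ → ℂ)) := by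
    rw [← hrank, Module.finrank_eq_rank]
    exact Submodule.rank_mono hle
  have hlo : Module.rank ℂ A = (Module.finrank ℂ A : Cardinal) := (Module.finrank_eq_rank ..).symm
  -- `dim A` counts the eigenvalues strictly below `E`, and `E` itself contributes two more, so it
  -- occupies the next two positions.
  refine ⟨Module.finrank ℂ A + 1, by omega, ⟨?_, le_trans ?_ hup⟩, ⟨?_, le_trans ?_ hup⟩⟩
  · rw [← hA, hlo]
    exact_mod_cast Nat.lt_succ_self _
  · exact_mod_cast Nat.le_succ _
  · rw [← hA, hlo]
    exact_mod_cast (by omega : Module.finrank ℂ A < Module.finrank ℂ A + 1 + 1)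
  · exact le_rfl

end HalfPeriodic

/-- The Weierstrass M-test gives continuity and the bound; frequencies `2j` are invisible to the
shift by `1/2`. -/
lemma IsEvenIndexCosineSeries.exists_boundedContinuous {V : ℝ → ℝ}
    (hV : IsEvenIndexCosineSeries V) : ∃ W : ℝ →ᵇ ℝ, (∀ x, W x = V x) ∧
      (∀ x, W (x + 1 / 2) = W x) ∧ ∀ x, W (-x) = W x := by
  obtain ⟨v, hv, hs⟩ := hV
  have hb : ∀ (j : ℕ) (x : ℝ), ‖v j * Real.cos (2 * Real.pi * (2 * j) * x)‖ ≤ |v j| := by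
    intro j x
    rw [norm_mul, Real.norm_eq_abs, Real.norm_eq_abs]
    exact mul_le_of_le_one_right (abs_nonneg _) (Real.abs_cos_le_one _)
  have hc : Continuous V := by
    have : V = fun x => ∑' j : ℕ, v j * Real.cos (2 * Real.pi * (2 * j) * x) :=
      funext fun x => (hs x).tsum_eq.symm
    rw [this]
    exact continuous_tsum (fun j => by fun_prop) hv hb
  refine ⟨BoundedContinuousFunction.ofNormedAddCommGroup V hc (∑' j, |v j|) fun x => ?_,
    fun x => rfl, fun x => (hs _).unique ?_, fun x => (hs _).unique ?_⟩
  · rw [← (hs x).tsum_eq]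
    exact tsum_of_norm_bounded hv.hasSum fun j => hb j x
  · change HasSum _ (V x)
    convert hs x using 3 with j
    rw [show 2 * Real.pi * (2 * (j : ℝ)) * (x + 1 / 2) =
      2 * Real.pi * (2 * j) * x + j * (2 * Real.pi) by ring, Real.cos_add_nat_mul_two_pi]
  · change HasSum _ (V x)
    convert hs x using 3 with j
    rw [mul_neg, Real.cos_neg]

/-! ### Floquet solutions and the orthonormal basis -/

/-- A Floquet solution with multiplier `μ` over half a period. -/
lemma exists_isSol_multiplier {q : ℝ →ᵇ ℝ} (hp : ∀ x, q (x + 1 / 2) = q x)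
    (he : ∀ x, q (-x) = q x) {μ : ℂ} (hμ : μ.im ≠ 0) (hD : (discriminant q : ℂ) = μ + μ⁻¹) :
    ∃ φ : ℝ → ℂ, φ ≠ 0 ∧ IsSol q φ ∧ ∀ x, φ (x + 1 / 2) = μ * φ x := by
  have hμ0 : μ ≠ 0 := fun h => hμ (by simp [h])
  have hc := isSol_realSol 1 0 q
  -- This is `(T - μ⁻¹) c`, annihilated by `T - μ` because `T² - D T + 1 = (T - μ)(T - μ⁻¹)`. It is
  -- nonzero since `c` is real with `c 0 = 1` and `μ⁻¹` is not real.
  refine ⟨fun x => (realSol 1 0 q (x + 1 / 2) : ℂ) - μ⁻¹ * realSol 1 0 q x, fun h => ?_,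
    (hc.comp_add_const hp).sub (hc.const_mul _), fun x => ?_⟩
  · have h1 := congrArg Complex.im (congrFun h 0)
    simp [realSol_zero] at h1
    rcases h1 with h1 | h1
    · exact hμ h1
    · exact hμ0 h1
  · have h := hc.translate_add_translate hp he x
    simp only [show x + 1 / 2 + 1 / 2 = x + 1 by ring]
    rw [hD] at h
    have h2 := mul_inv_cancel₀ hμ0
    linear_combination h + (realSol 1 0 q x : ℂ) * h2

section HalfPeriodic

variable {W : ℝ →ᵇ ℝ}

/-- `D = 0 = i + i⁻¹` provides a solution with multiplier `i`; its inversion has multiplier `-i`, so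
`conj Φ · 𝓘Φ` changes sign under a half period and integrates to zero. -/
lemma exists_orthonormal_basis_eigenspace (hp : ∀ x, W (x + 1 / 2) = W x)
    (he : ∀ x, W (-x) = W x) {E : ℝ} (hD : discriminant (energyShift W E) = 0) :
    ∃ Φ ∈ L2kEven Real.pi ⊓ H2k Real.pi,
      Submodule.span ℂ {Φ, inversion Φ} = eigenspace W Real.pi E ∧
      inner01 Φ Φ = 1 ∧ inner01 (inversion Φ) (inversion Φ) = 1 ∧
      inner01 Φ (inversion Φ) = 0 ∧ inner01 (inversion Φ) Φ = 0 := by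
  have hpE := energyShift_add_half hp E
  have heE := energyShift_neg he E
  obtain ⟨φ, hφ0, hφ, hφI⟩ := exists_isSol_multiplier hpE heE (μ := Complex.I) (by simp)
    (by rw [hD]; simp)
  have hφ1 : ∀ x, φ (x + 1) = -φ x := fun x => by
    rw [add_half_add_half hφI, Complex.I_mul_I, neg_one_mul]
  obtain ⟨r, hr, hin⟩ := inner01_self_pos hφ.continuous hφ1 hφ0
  obtain ⟨Φ, hΦdef⟩ : ∃ Φ : ℝ → ℂ, Φ = fun x => (((Real.sqrt r)⁻¹ : ℝ) : ℂ) * φ x := ⟨_, rfl⟩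
  have hΦ : IsSol (energyShift W E) Φ := hΦdef ▸ hφ.const_mul _
  have hΦI : ∀ x, Φ (x + 1 / 2) = Complex.I * Φ x := fun x => by
    simp only [hΦdef, hφI]
    ring
  have hΦ1 : ∀ x, Φ (x + 1) = -Φ x := fun x => by
    rw [add_half_add_half hΦI, Complex.I_mul_I, neg_one_mul]
  have hSI : ∀ x, inversion Φ (x + 1 / 2) = -Complex.I * inversion Φ x :=
    inversion_comp_add_half hΦI (by simp)
  have hS : IsSol (energyShift W E) (inversion Φ) := hΦ.comp_neg heE
  have h11 : inner01 Φ Φ = 1 := by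
    have e : inner01 Φ Φ = ((Real.sqrt r)⁻¹ : ℝ) * (((Real.sqrt r)⁻¹ : ℝ) * inner01 φ φ) := by
      unfold inner01
      rw [← intervalIntegral.integral_const_mul, ← intervalIntegral.integral_const_mul]
      congr 1
      funext x
      simp only [hΦdef, map_mul, Complex.conj_ofReal]
      ring
    rw [e, hin, ← Complex.ofReal_mul, ← Complex.ofReal_mul, ← mul_assoc, ← mul_inv,
      Real.mul_self_sqrt hr.le, inv_mul_cancel₀ hr.ne', Complex.ofReal_one]
  have h22 : inner01 (inversion Φ) (inversion Φ) = 1 := by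
    rw [← h11]
    unfold inner01
    have hper : Function.Periodic (fun x => (starRingEnd ℂ) (Φ x) * Φ x) 1 := fun x => by
      simp [hΦ1]
    change ∫ x in (0 : ℝ)..1, (starRingEnd ℂ) (Φ (-x)) * Φ (-x) = _
    rw [intervalIntegral.integral_comp_neg (fun x => (starRingEnd ℂ) (Φ x) * Φ x)]
    have := hper.intervalIntegral_add_eq (-1) 0
    simpa using this
  have h12 : inner01 Φ (inversion Φ) = 0 := integral_eq_zero_of_antiperiodic fun x => by
    rw [hΦI, hSI, map_mul, Complex.conj_I]
    linear_combination ((starRingEnd ℂ) (Φ x) * inversion Φ x) * Complex.I_sq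
  have h21 : inner01 (inversion Φ) Φ = 0 := integral_eq_zero_of_antiperiodic fun x => by
    rw [hΦI, hSI, map_mul, map_neg, Complex.conj_I]
    linear_combination ((starRingEnd ℂ) (inversion Φ x) * Φ x) * Complex.I_sq
  have hm1 := mem_eigenspace_of_discriminant_eq_zero hp he hD hΦ
  have hm2 := mem_eigenspace_of_discriminant_eq_zero hp he hD hS
  refine ⟨Φ, mem_even_inf_H2k_pi.2 ⟨hm1.1.1, hΦI⟩, ?_, h11, h22, h12, h21⟩
  have hcΦ := hΦ.continuous
  have hcS := hS.continuous
  have hli : LinearIndependent ℂ ![Φ, inversion Φ] := by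
    rw [LinearIndependent.pair_iff]
    intro a b hab
    have e : ∀ x, a * Φ x + b * inversion Φ x = 0 := fun x => congrFun hab x
    -- Shifting by `1/2` separates the two multipliers.
    have e' : ∀ x, a * Φ x - b * inversion Φ x = 0 := fun x => by
      have h := e (x + 1 / 2)
      rw [hΦI, hSI] at h
      have : Complex.I * (a * Φ x - b * inversion Φ x) = 0 := by linear_combination h
      exact (mul_eq_zero.1 this).resolve_left Complex.I_ne_zero
    obtain ⟨x, hx⟩ : ∃ x, Φ x ≠ 0 := by
      by_contra hcon
      push Not at hcon
      simp [inner01, hcon] at h11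
    constructor
    · have : a * Φ x = 0 := by linear_combination (1 / 2 : ℂ) * (e x + e' x)
      exact (mul_eq_zero.1 this).resolve_right hx
    · have : b * inversion Φ (-x) = 0 := by
        linear_combination (1 / 2 : ℂ) * (e (-x) - e' (-x))
      refine (mul_eq_zero.1 this).resolve_right ?_
      change Φ (- -x) ≠ 0
      rwa [neg_neg]
  have hspan : Submodule.span ℂ {Φ, inversion Φ} ≤ eigenspace W Real.pi E := by
    rw [Submodule.span_le]
    rintro f (rfl | rfl)
    · exact hm1
    · exact hm2
  refine Submodule.eq_of_le_of_finrank_eq hspan ?_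
  rw [finrank_eigenspace_eq_two hp he hD, ← Matrix.range_cons_cons_empty Φ (inversion Φ) ![],
    finrank_span_eq_card hli, Fintype.card_fin]

/-- The multiplier is `μ = σ e^{ik/2}`, with `μ² = e^{ik}` and `μ + μ⁻¹ = 2σ cos (k/2)`; `hk` makes
it nonreal. -/
lemma exists_mem_eigenspace_of_discriminant (hp : ∀ x, W (x + 1 / 2) = W x)
    (he : ∀ x, W (-x) = W x) {k E : ℝ} {σ : ℝ} (hσ : σ * σ = 1) (hk : Real.sin (k / 2) ≠ 0)
    (hD : discriminant (energyShift W E) = σ * (2 * Real.cos (k / 2))) :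
    ∃ φ : ℝ → ℂ, φ ≠ 0 ∧ φ ∈ eigenspace W k E := by
  have hσ0 : σ ≠ 0 := fun h => by simp [h] at hσ
  have hσC : (σ : ℂ) * σ = 1 := by exact_mod_cast hσ
  have hinv : ((σ : ℂ) * Complex.exp ((k / 2 : ℝ) * Complex.I))⁻¹ =
      σ * Complex.exp (-((k / 2 : ℝ) * Complex.I)) := by
    rw [mul_inv, ← Complex.exp_neg, inv_eq_of_mul_eq_one_right hσC]
  obtain ⟨φ, h0, h1, h2⟩ := exists_isSol_multiplier (energyShift_add_half hp E)
    (energyShift_neg he E) (μ := σ * Complex.exp ((k / 2 : ℝ) * Complex.I))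
    (by
      rw [Complex.im_ofReal_mul, Complex.exp_ofReal_mul_I_im]
      exact mul_ne_zero hσ0 hk)
    (by
      rw [hinv, hD]
      push_cast
      rw [Complex.two_cos]
      ring_nf)
  refine ⟨φ, h0, mem_eigenspace_iff.2 ⟨h1, fun x => ?_⟩⟩
  rw [add_half_add_half h2, mul_mul_mul_comm, hσC, ← Complex.exp_add, one_mul]
  congr 2
  push_cast
  ring

end HalfPeriodic

/-! ### Analytic implicit branches and linear factors -/

lemma exists_analytic_implicit {F : ℝ × ℝ → ℝ} {e₀ β : ℝ} (hF : AnalyticAt ℝ F (0, e₀))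
    (h0 : F (0, e₀) = 0) (hd : HasDerivAt (fun e => F (0, e)) β e₀) (hβ : β ≠ 0) :
    ∃ r > 0, ∃ G : ℝ × ℝ → ℝ, G (0, 0) = e₀ ∧
      ∀ ε d : ℝ, |ε| < r → |d| < r → AnalyticAt ℝ G (ε, d) ∧ F (ε, G (ε, d)) = d := by
  -- The value `d` is a parameter alongside `ε`, so one function `G` and one radius serve all small
  -- `ε`, with the local inverse in `d` included.
  let f : (ℝ × ℝ) × ℝ → ℝ := fun p => F (p.1.1, p.2) - p.1.2
  have hf : ContDiffAt ℝ ω f ((0, 0), e₀) := by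
    refine ContDiffAt.sub ?_ (by fun_prop)
    exact ContDiffAt.comp (f := fun p : (ℝ × ℝ) × ℝ => (p.1.1, p.2)) ((0, 0), e₀)
      hF.contDiffAt (by fun_prop)
  have hω : (ω : WithTop ℕ∞) ≠ 0 := by simp
  have hd' : HasDerivAt (fun e => f ((0, 0), e)) β e₀ := by simpa [f] using hd
  have hinv : (fderiv ℝ f ((0, 0), e₀) ∘L .inr ℝ (ℝ × ℝ) ℝ).IsInvertible := by
    refine ⟨ContinuousLinearEquiv.unitsEquivAut ℝ (Units.mk0 β hβ), ?_⟩
    ext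
    have hfd := (hf.differentiableAt hω).hasFDerivAt
    have h2 : HasDerivAt (fun e : ℝ => (((0 : ℝ), (0 : ℝ)), e)) (((0 : ℝ), (0 : ℝ)), 1) e₀ :=
      (hasDerivAt_const e₀ _).prodMk (hasDerivAt_id e₀)
    have h3 := hfd.comp_hasDerivAt e₀ h2
    have h4 := hd'.unique h3
    simp [h4]
    rfl
  have hana := (hf.contDiffAt_implicitFunction hω hinv).analyticAt.eventually_analyticAt
  have heq := hf.eventually_apply_implicitFunction hω hinv
  have hself := hf.implicitFunction_apply_self hω hinv
  obtain ⟨r, hr, hball⟩ := Metric.eventually_nhds_iff.1 (hana.and heq)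
  refine ⟨r, hr, hf.implicitFunction hω hinv, hself, fun ε d hε hd => ?_⟩
  obtain ⟨h1, h2⟩ := hball (y := (ε, d)) (by
    rw [Prod.dist_eq]
    simp [hε, hd])
  refine ⟨h1, ?_⟩
  simp only [f, h0, sub_zero] at h2
  linarith

/-- At `0` the power series of `h - h 0` is divided by the variable; elsewhere the difference
quotient is visibly analytic. -/
lemma contDiffOn_dslope_of_analyticOnNhd {h : ℝ → ℝ} {ζ : ℝ} (hζ : 0 < ζ)
    (hh : ∀ t ∈ Ioo (-ζ) ζ, AnalyticAt ℝ h t) : ContDiffOn ℝ ∞ (dslope h 0) (Ioo (-ζ) ζ) := by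
  intro t ht
  refine ContDiffAt.contDiffWithinAt ?_
  rcases eq_or_ne t 0 with rfl | hne
  · obtain ⟨p, hp⟩ := hh 0 ⟨by linarith, hζ⟩
    exact hp.has_fpower_series_dslope_fslope.analyticAt.contDiffAt
  · have h1 : AnalyticAt ℝ (fun t => (t - 0)⁻¹ * (h t - h 0)) t :=
      ((analyticAt_id.sub analyticAt_const).inv (by simpa using hne)).mul
        ((hh t ht).sub analyticAt_const)
    refine (h1.congr ?_).contDiffAt
    filter_upwards [isOpen_ne.mem_nhds hne] with s hs
    rw [dslope_of_ne _ hs, slope_def_field]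
    ring

lemma exists_linear_factor {h : ℝ → ℝ} {ζ lam : ℝ} (hζ : 0 < ζ)
    (hh : ∀ t ∈ Ioo (-ζ) ζ, AnalyticAt ℝ h t) (hd : HasDerivAt h lam 0) (hlam : lam ≠ 0) :
    ∃ η : ℝ → ℝ, ContDiffOn ℝ ∞ η (Ioo (-ζ) ζ) ∧ η 0 = 0 ∧
      ∀ t, h t - h 0 = lam * t * (1 + η t) := by
  refine ⟨fun t => dslope h 0 t / lam - 1,
    ((contDiffOn_dslope_of_analyticOnNhd hζ hh).div_const lam).sub contDiffOn_const, ?_,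
    fun t => ?_⟩
  · simp [dslope_same, hd.deriv, hlam]
  · have := sub_smul_dslope h 0 t
    rw [smul_eq_mul, sub_zero] at this
    rw [← this]
    field_simp
    ring

/-! ### The free operator and the two-parameter discriminant -/

lemma realSol_neg_const {E : ℝ} (hE : 0 < E) (x : ℝ) :
    realSol 1 0 (energyShift 0 E) x = Real.cos (Real.sqrt E * x) := by
  have hs : Real.sqrt E * Real.sqrt E = E := Real.mul_self_sqrt hE.le
  have h1 : ∀ x, HasDerivAt (fun x => Real.cos (Real.sqrt E * x))
      (-Real.sqrt E * Real.sin (Real.sqrt E * x)) x := fun x =>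
    (((hasDerivAt_id x).const_mul (Real.sqrt E)).cos).congr_deriv (by simp; ring)
  have h2 : ∀ x, HasDerivAt (fun x => -Real.sqrt E * Real.sin (Real.sqrt E * x))
      (-E * Real.cos (Real.sqrt E * x)) x := fun x =>
    ((((hasDerivAt_id x).const_mul (Real.sqrt E)).sin).const_mul (-Real.sqrt E)).congr_deriv (by
      simp only [id_eq, mul_one]
      linear_combination (-Real.cos (Real.sqrt E * x)) * hs)
  have hsol : IsSol (energyShift 0 E) (fun x => (Real.cos (Real.sqrt E * x) : ℂ)) :=
    .of_hasDerivAt (fun x => (h1 x).ofReal_comp) fun x =>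
      ((h2 x).ofReal_comp).congr_deriv (by
        rw [energyShift_apply]
        simp)
  have h := (isSol_realSol 1 0 (energyShift 0 E)).ext hsol (a := 0) (by simp [realSol_zero])
    (by rw [deriv_realSol_zero, (h1 0).ofReal_comp.deriv]; simp)
  exact_mod_cast congrFun h x

lemma discriminant_neg_const {E : ℝ} (hE : 0 < E) :
    discriminant (energyShift 0 E) = 2 * Real.cos (Real.sqrt E / 2) := by
  rw [discriminant, realSol_neg_const hE]
  ring_nf

lemma hasDerivAt_discriminant_neg_const {E : ℝ} (hE : 0 < E) :
    HasDerivAt (fun E => discriminant (energyShift 0 E))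
      (-(Real.sin (Real.sqrt E / 2) / (2 * Real.sqrt E))) E := by
  have h := (((Real.hasDerivAt_sqrt hE.ne').div_const 2).cos).const_mul 2
  have hs := (Real.sqrt_pos.2 hE).ne'
  refine (h.congr_of_eventuallyEq ?_).congr_deriv ?_
  · filter_upwards [lt_mem_nhds hE] with F hF
    exact discriminant_neg_const hF
  · field_simp

lemma analyticAt_discriminant_family (W : ℝ →ᵇ ℝ) (p : ℝ × ℝ) :
    AnalyticAt ℝ (fun p : ℝ × ℝ => discriminant (energyShift (p.1 • W) p.2)) p :=
  AnalyticAt.comp (f := fun p : ℝ × ℝ => energyShift (p.1 • W) p.2) (analyticAt_discriminant _)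
    ((analyticAt_fst.smul analyticAt_const).sub (analyticAt_snd.smul analyticAt_const))

/-- The discriminant crosses zero transversally at the energies `(π (2 n + 1))²` of the free
operator. -/
lemma free_crossing (n : ℕ) :
    discriminant (energyShift 0 (Real.pi ^ 2 * (2 * (n : ℝ) + 1) ^ 2)) = 0 ∧
    ∃ β : ℝ, β ≠ 0 ∧ HasDerivAt (fun E => discriminant (energyShift 0 E)) β
      (Real.pi ^ 2 * (2 * (n : ℝ) + 1) ^ 2) := by
  have hpos : 0 < Real.pi * (2 * (n : ℝ) + 1) := by positivity
  have hE : 0 < Real.pi ^ 2 * (2 * (n : ℝ) + 1) ^ 2 := by positivity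
  have hsqrt : Real.sqrt (Real.pi ^ 2 * (2 * (n : ℝ) + 1) ^ 2) = Real.pi * (2 * n + 1) := by
    rw [← mul_pow, Real.sqrt_sq hpos.le]
  have hcos : Real.cos (Real.pi * (2 * n + 1) / 2) = 0 :=
    Real.cos_eq_zero_iff.2 ⟨n, by push_cast; ring⟩
  refine ⟨by rw [discriminant_neg_const hE, hsqrt, hcos, mul_zero], _, ?_,
    hasDerivAt_discriminant_neg_const hE⟩
  rw [hsqrt]
  have hsin : Real.sin (Real.pi * (2 * n + 1) / 2) ≠ 0 := fun h => by
    have := Real.sin_sq_add_cos_sq (Real.pi * (2 * n + 1) / 2)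
    rw [h, hcos] at this
    norm_num at this
  exact neg_ne_zero.2 (div_ne_zero hsin (by positivity))

/-! ### The linear crossing and the Dirac point -/

section HalfPeriodic

variable {W : ℝ →ᵇ ℝ}

lemma exists_linear_crossing (hp : ∀ x, W (x + 1 / 2) = W x) (he : ∀ x, W (-x) = W x)
    {g : ℝ → ℝ} {r : ℝ} (hr : 0 < r) (hg : ∀ d, |d| < r → AnalyticAt ℝ g d)
    (hD : ∀ d, |d| < r → discriminant (energyShift W (g d)) = d) :
    ∃ lam : ℝ, lam ≠ 0 ∧ ∃ ζ₀ : ℝ, 0 < ζ₀ ∧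
    ∃ (Φp Φm : ℝ → ℝ → ℂ) (Ep Em ηp ηm : ℝ → ℝ),
      IsFloquetBlochFamily W (Ioo (Real.pi - ζ₀) (Real.pi + ζ₀)) Φp Ep ∧
      IsFloquetBlochFamily W (Ioo (Real.pi - ζ₀) (Real.pi + ζ₀)) Φm Em ∧
      ContDiffOn ℝ ∞ ηp (Ioo (-ζ₀) ζ₀) ∧ ηp 0 = 0 ∧
      ContDiffOn ℝ ∞ ηm (Ioo (-ζ₀) ζ₀) ∧ ηm 0 = 0 ∧
      (∀ k ∈ Ioo (Real.pi - ζ₀) (Real.pi + ζ₀),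
        Ep k - g 0 = lam * (k - Real.pi) * (1 + ηp (k - Real.pi))) ∧
      (∀ k ∈ Ioo (Real.pi - ζ₀) (Real.pi + ζ₀),
        Em k - g 0 = -lam * (k - Real.pi) * (1 + ηm (k - Real.pi))) := by
  have hsmall : ∀ t : ℝ, |-2 * Real.sin (t / 2)| ≤ |t| := fun t => by
    have h := Real.abs_sin_le_abs (x := t / 2)
    rw [abs_div, abs_two] at h
    rw [abs_mul, abs_neg, abs_two]
    linarith
  -- The bound `r` keeps `-2 sin (t/2)` in the domain of `g`; the bound `1` keeps `k/2` inside `(0,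
  -- π)`, where the multiplier is nonreal.
  set ζ := min r 1 with hζdef
  have hζ : 0 < ζ := lt_min hr one_pos
  have habs : ∀ t ∈ Ioo (-ζ) ζ, |-2 * Real.sin (t / 2)| < r := fun t ht =>
    (hsmall t).trans_lt ((abs_lt.2 ht).trans_le (min_le_left _ _))
  have hsin : ∀ t : ℝ, HasDerivAt (fun t => -2 * Real.sin (t / 2)) (-Real.cos (t / 2)) t :=
    fun t => ((((hasDerivAt_id t).div_const 2).sin).const_mul (-2)).congr_deriv (by
      simp only [id_eq]
      ring)
  have hana : ∀ t ∈ Ioo (-ζ) ζ, AnalyticAt ℝ (fun t => g (-2 * Real.sin (t / 2))) t :=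
    fun t ht => AnalyticAt.comp (f := fun t => -2 * Real.sin (t / 2)) (hg _ (habs t ht)) (by
      have : ContDiff ℝ ω (fun t : ℝ => -2 * Real.sin (t / 2)) := by fun_prop
      exact this.contDiffAt.analyticAt)
  have hg0 := (hg 0 (by simpa using hr)).differentiableAt.hasDerivAt
  -- Chain rule for `D ∘ g = id`: no separate transversality check is needed for the perturbed
  -- potential.
  have hg' : deriv g 0 ≠ 0 := by
    intro h
    have h1 := (analyticAt_discriminant_sub W (g 0)).differentiableAt.hasDerivAt.comp 0 hg0
    rw [h, mul_zero] at h1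
    have h2 : HasDerivAt ((fun E => discriminant (energyShift W E)) ∘ g) 1 0 := by
      refine (hasDerivAt_id (0 : ℝ)).congr_of_eventuallyEq ?_
      have : ∀ᶠ d : ℝ in nhds 0, |d| < r := by
        refine (continuous_abs.tendsto 0).eventually_lt_const ?_
        simpa using hr
      filter_upwards [this] with d hd using hD d hd
    exact one_ne_zero (h2.unique h1)
  have hder : HasDerivAt (fun t => g (-2 * Real.sin (t / 2))) (-deriv g 0) 0 := by
    have h := HasDerivAt.comp (h₂ := g) (h₂' := deriv g 0) (0 : ℝ) (by simpa using hg0) (hsin 0)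
    exact h.congr_deriv (by simp)
  obtain ⟨η, hη, hη0, hηh⟩ := exists_linear_factor hζ hana hder (neg_ne_zero.2 hg')
  have hg00 : g (-2 * Real.sin (0 / 2)) = g 0 := by simp
  simp only [hg00] at hηh
  have hmem : ∀ k ∈ Ioo (Real.pi - ζ) (Real.pi + ζ), k - Real.pi ∈ Ioo (-ζ) ζ := fun k hk =>
    ⟨by linarith [hk.1], by linarith [hk.2]⟩
  have hcos : ∀ k : ℝ, 2 * Real.cos (k / 2) = -2 * Real.sin ((k - Real.pi) / 2) := fun k => by
    rw [sub_div, Real.sin_sub_pi_div_two]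
    ring
  have hex : ∀ σ : ℝ, σ * σ = 1 → ∀ k ∈ Ioo (Real.pi - ζ) (Real.pi + ζ), ∃ φ : ℝ → ℂ, φ ≠ 0 ∧
      φ ∈ eigenspace W k (g (σ * (-2 * Real.sin ((k - Real.pi) / 2)))) := by
    intro σ hσ k hk
    refine exists_mem_eigenspace_of_discriminant hp he hσ ?_ ?_
    · have h3 := Real.pi_gt_three
      have h1 : ζ ≤ 1 := min_le_right _ _
      exact (Real.sin_pos_of_pos_of_lt_pi (by linarith [hk.1]) (by linarith [hk.2])).ne'
    · rw [hcos, hD]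
      have : |σ| = 1 := by
        have h := congrArg (fun x => |x|) hσ
        simp only [abs_mul, abs_one] at h
        nlinarith [abs_nonneg σ]
      rw [abs_mul, this, one_mul]
      exact habs _ (hmem k hk)
  choose! Φp hΦp0 hΦp using hex 1 (by norm_num)
  choose! Φm hΦm0 hΦm using hex (-1) (by norm_num)
  -- The sine is odd, so the minus branch is the reflection of the plus branch about `k = π`, whence
  -- `ηm t = η (-t)`.
  refine ⟨-deriv g 0, neg_ne_zero.2 hg', ζ, hζ, Φp, Φm, _, _, η, fun t => η (-t),
    fun k hk => ⟨hΦp0 k hk, hΦp k hk⟩, fun k hk => ⟨hΦm0 k hk, hΦm k hk⟩, hη, hη0, ?_,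
    by simpa using hη0, fun k _ => ?_, fun k _ => ?_⟩
  · refine hη.comp contDiff_neg.contDiffOn fun t ht => ⟨?_, ?_⟩
    · linarith [ht.2]
    · linarith [ht.1]
  · rw [one_mul]
    exact hηh _
  · have h := hηh (-(k - Real.pi))
    rw [neg_div, Real.sin_neg] at h
    rw [show (-1 : ℝ) * (-2 * Real.sin ((k - Real.pi) / 2)) =
      -2 * -Real.sin ((k - Real.pi) / 2) by ring, h]
    ring

lemma isDiracPoint_of_branch (hp : ∀ x, W (x + 1 / 2) = W x) (he : ∀ x, W (-x) = W x)
    {g : ℝ → ℝ} {r : ℝ} (hr : 0 < r) (hg : ∀ d, |d| < r → AnalyticAt ℝ g d)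
    (hD : ∀ d, |d| < r → discriminant (energyShift W (g d)) = d) :
    IsDiracPoint W Real.pi (g 0) (L2kEven Real.pi) (L2kOdd Real.pi) inversion := by
  have hD0 : discriminant (energyShift W (g 0)) = 0 := hD 0 (by simpa using hr)
  exact
    { mem_brillouin := ⟨Real.pi_pos.le, by linarith [Real.pi_pos]⟩
      consecutive_bands := exists_isBandEnergy hp he hD0
      multiplicity_two := finrank_eigenspace_eq_two hp he hD0
      LA_le := fun _ hf => hf.1
      LB_le := fun _ hf => hf.1
      disjoint := disjoint_even_odd
      sup_eq := even_sup_odd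
      maps_A := fun f hf => by
        obtain ⟨h1, h2⟩ := mem_even_inf_H2k_pi.1 hf
        exact mem_L2kEven_pi (h1.memL2Loc_schrodinger W.continuous)
          (schrodinger_comp_add_const hp h2)
      maps_B := fun f hf => by
        obtain ⟨h1, h2⟩ := mem_odd_inf_H2k_pi.1 hf
        exact mem_L2kOdd_pi (h1.memL2Loc_schrodinger W.continuous)
          (schrodinger_comp_add_const hp h2)
      S_ae := fun _ _ => inversion_ae_eq
      S_maps_A := fun _ => inversion_mem_odd
      S_maps_B := fun _ => inversion_mem_even
      S_involutive := fun f _ => funext fun x => congrArg f (neg_neg x)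
      S_commutes := fun f _ => by rw [schrodinger_inversion he]
      exists_basis := exists_orthonormal_basis_eigenspace hp he hD0
      linear_crossing := exists_linear_crossing hp he hr hg hD }

end HalfPeriodic

end Hill

end

theorem theorem3p2 (V : ℝ → ℝ) (hV : Hill.IsEvenIndexCosineSeries V) (n : ℕ) (hn : 1 ≤ n) :
    ∃ ε₀ : ℝ, 0 < ε₀ ∧ ∃ E : ℝ → ℝ,
      ContinuousOn E (Set.Ioo (-ε₀) ε₀) ∧
      E 0 = Real.pi ^ 2 * (2 * (n : ℝ) + 1) ^ 2 ∧
      ∀ ε ∈ Set.Ioo (-ε₀) ε₀,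
        Hill.IsDiracPoint (fun x => ε * V x) Real.pi (E ε)
          (Hill.L2kEven Real.pi) (Hill.L2kOdd Real.pi) Hill.inversion := by
  obtain ⟨W, hWV, hp, he⟩ := hV.exists_boundedContinuous
  obtain ⟨h0, β, hβ, hd⟩ := Hill.free_crossing n
  obtain ⟨r, hr, G, hG0, hG⟩ := Hill.exists_analytic_implicit
    (Hill.analyticAt_discriminant_family W (0, Real.pi ^ 2 * (2 * (n : ℝ) + 1) ^ 2))
    (by simpa using h0) (by simpa using hd) hβ
  -- The Dirac energy solves `D = 0`; for each fixed `ε` the slice `d ↦ G (ε, d)` is the local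
  -- inverse used for the crossing.
  refine ⟨r, hr, fun ε => G (ε, 0), fun ε hε => ?_, hG0, fun ε hε => ?_⟩
  · have h := (hG ε 0 (abs_lt.2 hε) (by simpa using hr)).1.continuousAt
    exact (ContinuousAt.comp (f := fun ε : ℝ => (ε, (0 : ℝ))) h
      (by fun_prop)).continuousWithinAt
  · have e : (fun x => ε * V x) = ⇑(ε • W) := by
      funext x
      rw [← hWV]
      rfl
    rw [e]
    refine Hill.isDiracPoint_of_branch (W := ε • W) (g := fun d => G (ε, d)) (fun x => ?_)
      (fun x => ?_) hr (fun d hd => ?_) fun d hd => ?_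
    · simp only [BoundedContinuousFunction.coe_smul, hp]
    · simp only [BoundedContinuousFunction.coe_smul, he]
    · exact AnalyticAt.comp (f := fun d : ℝ => (ε, d)) (hG ε d (abs_lt.2 hε) hd).1
        (analyticAt_const.prod analyticAt_id)
    · exact (hG ε d (abs_lt.2 hε) hd).2
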